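/- Let $F$ be a field, $q\in F$ invertible, and let $\mathscr H$ be the Hecke algebra of the symmetric group $\mathfrak S_n$ (acting on the right on $\{1,\dots,n\}$, with basic transpositions $s_i=(i,i+1)$ and length function $\ell$): the $F$-algebra with basis $\{T_w\mid w\in\mathfrak S_n\}$ in which $T_wT_{s_i}=T_{ws_i}$ if $\ell(ws_i)=\ell(w)+1$ and $T_wT_{s_i}=qT_{ws_i}+(q-1)T_w$ otherwise. For a composition $\lambda$ of $n$ (parts equal to $0$ are allowed) let $\mathfrak t^\lambda$ be the $\lambda$-tableau with $1,\dots,n$ entered in order along its rows, let $\mathfrak S_\lambda$ be its row stabilizer, $x_\lambda=\sum_{w\in\mathfrak S_\lambda}T_w$, and $M^\lambda=x_\lambda\mathscr H$, a right $\mathscr H$-module. For compositions $\lambda,\mu$ of $n$ let $\mathcal T(\lambda,\mu)$ be the set of $\lambda$-tableaux of type $\mu$ (fillings of the diagram of $\lambda$ with $\mu_r$ entries equal to $r$ for every $r$). Such a tableau is row standard if its entries weakly increase along the rows, and $A\sim_r B$ means that for every $i$ row $i$ of $A$ and row $i$ of $B$ contain the same entries with multiplicity. For $A\in\mathcal T(\lambda,\mu)$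 let $1_A\in\mathfrak S_n$ be the permutation such that the rows of $\mathfrak t^\mu 1_A$ are increasing and $k$ lies in row $r$ of $\mathfrak t^\mu 1_A$ if the place occupied by $k$ in $\mathfrak t^\lambda$ is occupied by $r$ in $A$. Let $\Theta_A:M^\lambda\to M^\mu$ be the (well-defined) $\mathscr H$-homomorphism with $\Theta_A(x_\lambda h)=\bigl(x_\mu\sum_{A'\sim_r A}T_{1_{A'}}\bigr)h$ for all $h\in\mathscr H$. Let $\lambda$ and $\mu$ be partitions of $n$, let $d\ge 1$ and $0\le t<\mu_{d+1}$, and put $\bar t=\mu_{d+1}-t$. Let $\nu$ be the composition with $\nu_d=\mu_d+\mu_{d+1}-t$, $\nu_{d+1}=t$ and $\nu_i=\mu_i$ otherwise. Let $\psi_{d,t}=\Theta_R:M^\mu\to M^\nu$, where $R$ is the row standard $\mu$-tableau of type $\nu$ all of whose entries in row $i$ equal $i$, except that row $d+1$ contains $\bar t$ entries $d$ and $t$ entries $d+1$. Let $A\in\mathcal T(\lambda,\mu)$ be row standard, and let $\mathcal S\subseteq\mathcal T(\lambda,\nu)$ be the set of row standard tableaux that are obtained by replacing $\bar t$ entries $d+1$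 of $A$ by $d$. For $S\in\mathcal S$ and $i\ge 1$ let $\beta_i$ be the number of entries replaced in row $i$, let $x_i=\#\{(k,j)\mid k>i,\ A(k,j)=d\}$ and $y_i=\#\{j\mid S(i,j)=d\}$, and set $$b_S=\prod_{i\ge1}q^{x_i\beta_i}\begin{bmatrix}y_i\\ \beta_i\end{bmatrix}\in F,$$ where $\begin{bmatrix}\alpha\\ \beta\end{bmatrix}$ is the value at $q$ of the Gaussian polynomial $\dfrac{[\alpha]!}{[\beta]!\,[\alpha-\beta]!}\in\mathbb Z[X]$, with $[m]=1+X+\dots+X^{m-1}$ and $[m]!=[1][2]\cdots[m]$. Then $$\psi_{d,t}\,\Theta_A=\sum_{S\in\mathcal S}b_S\,\Theta_S .$$ -/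

import Mathlib

open Equiv Finset MulOpposite

/-! Permutations act on the right: the product `u v` (first `u`, then `v`) is `v * u` in Mathlib's
`Equiv.Perm`. All indices (letters, rows, columns, tableau entries) are counted from `0`. -/

namespace Hecke

/-! ### The symmetric group -/

/-- `w` is one of the basic transpositions `(i, i+1)`. -/
def IsSimple {n : ℕ} (w : Perm (Fin n)) : Prop :=
  ∃ a b : Fin n, (a : ℕ) + 1 = b ∧ w = swap a b

/-- The length of a permutation: the least length of a word in the basic transpositions. -/
noncomputable def length {n : ℕ} (w : Perm (Fin n)) : ℕ :=
  sInf {k | ∃ l : List (Perm (Fin n)), (∀ s ∈ l, IsSimple s) ∧ l.prod = w ∧ l.length = k}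

/-- The number of inversions. -/
def inv {n : ℕ} (w : Perm (Fin n)) : ℕ :=
  #{p : Fin n × Fin n | p.1 < p.2 ∧ w p.2 < w p.1}

theorem swap_lt_swap {n : ℕ} {a b : Fin n} (hab : (a : ℕ) + 1 = b) {x y : Fin n} (hxy : x < y)
    (h : ¬(x = a ∧ y = b)) : swap a b x < swap a b y := by
  rw [swap_apply_def, swap_apply_def]
  simp only [Fin.lt_def, Fin.ext_iff] at *
  split_ifs <;> omega

theorem inv_mul_swap {n : ℕ} {a b : Fin n} (hab : (a : ℕ) + 1 = b) (w : Perm (Fin n))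
    (hw : w a < w b) : inv (w * swap a b) = inv w + 1 := by
  have hlt : a < b := by rw [Fin.lt_def]; omega
  have key : ({p : Fin n × Fin n | p.1 < p.2 ∧ (w * swap a b) p.2 < (w * swap a b) p.1} :
      Finset (Fin n × Fin n)) = insert (a, b)
      ((({p : Fin n × Fin n | p.1 < p.2 ∧ w p.2 < w p.1} : Finset (Fin n × Fin n))).map
        ((swap a b).prodCongr (swap a b)).toEmbedding) := by
    ext ⟨x, y⟩
    simp only [mem_insert, mem_map_equiv, mem_filter]
    simp only [mem_univ, true_and, Perm.coe_mul, Function.comp_apply, Prod.mk.injEq]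
    by_cases h : x = a ∧ y = b
    · obtain ⟨rfl, rfl⟩ := h
      simp [hlt, hw]
    · simp only [h, false_or, prodCongr_symm, symm_swap, prodCongr_apply, Prod.map_apply]
      constructor
      · rintro ⟨h1, h2⟩
        exact ⟨swap_lt_swap hab h1 h, h2⟩
      · rintro ⟨h1, h2⟩
        refine ⟨?_, h2⟩
        by_cases h' : swap a b x = a ∧ swap a b y = b
        · obtain ⟨e1, e2⟩ := h'
          rw [e1, e2] at h2
          exact absurd h2 (not_lt.2 hw.le)
        · simpa using swap_lt_swap hab h1 h'
  rw [inv, key, card_insert_of_notMem, card_map, inv]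
  simp only [mem_map_equiv, prodCongr_symm, symm_swap, prodCongr_apply, Prod.map_apply,
    swap_apply_left, swap_apply_right, mem_filter, mem_univ, true_and, not_and, not_lt]
  intro h
  exact absurd h (not_lt.2 hlt.le)

theorem inv_one {n : ℕ} : inv (1 : Perm (Fin n)) = 0 := by
  rw [inv, card_eq_zero, filter_eq_empty_iff]
  rintro ⟨x, y⟩ - ⟨h1, h2⟩
  exact absurd h1 (not_lt.2 (le_of_lt h2))

theorem eq_one_of_lt {n : ℕ} (w : Perm (Fin n))
    (h : ∀ a b : Fin n, (a : ℕ) + 1 = b → w a < w b) : w = 1 := by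
  rw [← Perm.monotone_iff]
  cases n with
  | zero => intro a; exact a.elim0
  | succ n =>
    exact (Fin.strictMono_iff_lt_succ.2 fun i => h _ _ (by simp)).monotone

/-- Induction on a permutation along right multiplication by ascents. -/
theorem perm_induction {n : ℕ} {P : Perm (Fin n) → Prop} (h1 : P 1)
    (hs : ∀ (w : Perm (Fin n)) (a b : Fin n), (a : ℕ) + 1 = b → w a < w b → P w →
      P (w * swap a b)) (w : Perm (Fin n)) : P w := by
  induction hk : inv w using Nat.strong_induction_on generalizing w with
  | _ k ih =>
    by_cases h : ∀ a b : Fin n, (a : ℕ) + 1 = b → w a < w b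
    · rw [eq_one_of_lt w h]; exact h1
    · push Not at h
      obtain ⟨a, b, hab, hw⟩ := h
      have hne : w b ≠ w a := fun e => by have := w.injective e; subst this; omega
      have hlt : (w * swap a b) a < (w * swap a b) b := by
        simpa using lt_of_le_of_ne hw hne
      have e : w = (w * swap a b) * swap a b := by simp [mul_assoc]
      have hinv := inv_mul_swap hab _ hlt
      rw [← e] at hinv
      rw [e]
      exact hs _ a b hab hlt (ih _ (by omega) _ rfl)

theorem perm_induction' {n : ℕ} {P : Perm (Fin n) → Prop} (h1 : P 1)
    (hs : ∀ (w : Perm (Fin n)) (a b : Fin n), (a : ℕ) + 1 = b → w⁻¹ a < w⁻¹ b → P w →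
      P (swap a b * w)) (w : Perm (Fin n)) : P w := by
  have := perm_induction (P := fun w => P w⁻¹) (by simpa using h1)
    (fun w a b hab hw h => by simpa using hs w⁻¹ a b hab (by simpa using hw) h) w⁻¹
  simpa using this

theorem inv_mul_le {n : ℕ} (w s : Perm (Fin n)) (hs : IsSimple s) : inv (w * s) ≤ inv w + 1 := by
  obtain ⟨a, b, hab, rfl⟩ := hs
  have hne : w a ≠ w b := fun e => by have := w.injective e; subst this; omega
  rcases lt_or_gt_of_ne hne with h | h
  · exact (inv_mul_swap hab w h).le
  · have := inv_mul_swap hab (w * swap a b) (by simpa using h)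
    rw [mul_assoc, swap_mul_self, mul_one] at this
    omega

theorem length_eq_inv {n : ℕ} (w : Perm (Fin n)) : length w = inv w := by
  have hmem : inv w ∈ {k | ∃ l : List (Perm (Fin n)),
      (∀ s ∈ l, IsSimple s) ∧ l.prod = w ∧ l.length = k} := by
    refine perm_induction (P := fun w => ∃ l : List (Perm (Fin n)),
      (∀ s ∈ l, IsSimple s) ∧ l.prod = w ∧ l.length = inv w) ⟨[], by simp [inv_one]⟩ ?_ w
    rintro w a b hab hw ⟨l, h1, h2, h3⟩
    refine ⟨l ++ [swap a b], ?_, by simp [h2], by simp [h3, inv_mul_swap hab w hw]⟩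
    intro s hs
    rcases List.mem_append.1 hs with hs | hs
    · exact h1 s hs
    · rw [List.mem_singleton.1 hs]; exact ⟨a, b, hab, rfl⟩
  refine le_antisymm (Nat.sInf_le hmem) (le_csInf ⟨_, hmem⟩ ?_)
  clear hmem
  rintro k ⟨l, h1, rfl, rfl⟩
  induction l using List.reverseRecOn with
  | nil => simp [inv_one]
  | append_singleton l s ih =>
    have := inv_mul_le l.prod s (h1 s (by simp))
    have := ih fun x hx => h1 x (by simp [hx])
    simp only [List.prod_append, List.prod_singleton, List.length_append, List.length_singleton]
    omega

theorem inv_inv {n : ℕ} (w : Perm (Fin n)) : inv w⁻¹ = inv w := by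
  unfold inv
  refine card_bij' (fun p _ => (w⁻¹ p.2, w⁻¹ p.1)) (fun p _ => (w p.2, w p.1)) ?_ ?_ ?_ ?_ <;>
    simp +contextual

/-- `ℓ(s w)` compared with `ℓ(w)` for a basic transposition `s` (right action). -/
theorem length_mul_swap {n : ℕ} {a b : Fin n} (hab : (a : ℕ) + 1 = b) (w : Perm (Fin n))
    (hw : w a < w b) : length (w * swap a b) = length w + 1 := by
  rw [length_eq_inv, length_eq_inv, inv_mul_swap hab w hw]

/-- `ℓ(w s)` compared with `ℓ(w)` for a basic transposition `s` (right action). -/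
theorem length_swap_mul {n : ℕ} {a b : Fin n} (hab : (a : ℕ) + 1 = b) (w : Perm (Fin n))
    (hw : w⁻¹ a < w⁻¹ b) : length (swap a b * w) = length w + 1 := by
  rw [length_eq_inv, length_eq_inv, ← inv_inv, ← inv_inv w, mul_inv_rev, swap_inv,
    inv_mul_swap hab _ hw]

end Hecke

/-! ### The Hecke algebra -/

/-- The Hecke algebra of the symmetric group on `n` letters: the free `F`-module on the
permutations, with the multiplication constructed below. -/
def HeckeAlgebra (F : Type*) [Field F] (_q : F) (n : ℕ) : Type _ := Perm (Fin n) →₀ F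

namespace HeckeAlgebra

open Hecke

variable {F : Type*} [Field F] {q : F} {n : ℕ}

noncomputable instance : AddCommGroup (HeckeAlgebra F q n) :=
  inferInstanceAs (AddCommGroup (Perm (Fin n) →₀ F))

noncomputable instance : Module F (HeckeAlgebra F q n) :=
  inferInstanceAs (Module F (Perm (Fin n) →₀ F))

variable (F q n) in
/-- The basis `T_w`. -/
noncomputable def basis : Module.Basis (Perm (Fin n)) F (HeckeAlgebra F q n) :=
  Module.Basis.ofRepr (LinearEquiv.refl F (Perm (Fin n) →₀ F))

variable (q) in
/-- The basis element `T_w`. -/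
noncomputable def T (w : Perm (Fin n)) : HeckeAlgebra F q n := basis F q n w

variable (q) in
/-- Left multiplication by `T_s`, where `s` is the basic transposition `(a b)`. -/
noncomputable def leftOp (a b : Fin n) : Module.End F (HeckeAlgebra F q n) :=
  (basis F q n).constr F fun w =>
    if w a < w b then T q (w * swap a b)
    else q • T q (w * swap a b) + (q - 1) • T q w

variable (q) in
/-- Right multiplication by `T_s`, where `s` is the basic transposition `(a b)`. -/
noncomputable def rightOp (a b : Fin n) : Module.End F (HeckeAlgebra F q n) :=
  (basis F q n).constr F fun w =>
    if w⁻¹ a < w⁻¹ b then T q (swap a b * w)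
    else q • T q (swap a b * w) + (q - 1) • T q w

theorem leftOp_T (a b : Fin n) (w : Perm (Fin n)) : leftOp q a b (T q w) =
    if w a < w b then T q (w * swap a b)
    else q • T q (w * swap a b) + (q - 1) • T q w :=
  (basis F q n).constr_basis F _ w

theorem rightOp_T (a b : Fin n) (w : Perm (Fin n)) : rightOp q a b (T q w) =
    if w⁻¹ a < w⁻¹ b then T q (swap a b * w)
    else q • T q (swap a b * w) + (q - 1) • T q w :=
  (basis F q n).constr_basis F _ w

theorem hom_ext {M : Type*} [AddCommGroup M] [Module F M] {f g : HeckeAlgebra F q n →ₗ[F] M}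
    (h : ∀ w, f (T q w) = g (T q w)) : f = g := (basis F q n).ext h

theorem swap_lt_iff {a b : Fin n} (hab : (a : ℕ) + 1 = b) {x y : Fin n}
    (h : ¬(x = a ∧ y = b)) (h' : ¬(x = b ∧ y = a)) : swap a b x < swap a b y ↔ x < y := by
  rw [swap_apply_def, swap_apply_def]
  simp only [Fin.lt_def, Fin.ext_iff] at *
  split_ifs <;> omega

theorem leftOp_rightOp {a b c d : Fin n} (hab : (a : ℕ) + 1 = b) (hcd : (c : ℕ) + 1 = d)
    (x : HeckeAlgebra F q n) : leftOp q a b (rightOp q c d x) = rightOp q c d (leftOp q a b x) := by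
  suffices h : leftOp q a b * rightOp q c d = rightOp q c d * leftOp q a b from
    LinearMap.congr_fun h x
  refine hom_ext fun w => ?_
  simp only [Module.End.mul_apply, rightOp_T, leftOp_T]
  have hc : c < d := by rw [Fin.lt_def]; omega
  have ha : a < b := by rw [Fin.lt_def]; omega
  by_cases h1 : w a = c ∧ w b = d
  · obtain ⟨rfl, rfl⟩ := h1
    have e : swap (w a) (w b) * w = w * swap a b := by rw [mul_swap_eq_swap_mul]
    simp [e, hc, ha, not_lt.2 hc.le, not_lt.2 ha.le, leftOp_T, rightOp_T, mul_assoc]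
    rw [← mul_assoc, e, mul_assoc, swap_mul_self, mul_one]
  by_cases h2 : w a = d ∧ w b = c
  · obtain ⟨rfl, rfl⟩ := h2
    have e : swap (w b) (w a) * w = w * swap a b := by rw [mul_swap_eq_swap_mul, swap_comm]
    simp [e, hc, ha, not_lt.2 hc.le, not_lt.2 ha.le, leftOp_T, rightOp_T, mul_assoc]
    rw [← mul_assoc, e, mul_assoc, swap_mul_self, mul_one]
  have i1 : (swap c d * w) a < (swap c d * w) b ↔ w a < w b := swap_lt_iff hcd h1 h2
  have i2 : (w * swap a b)⁻¹ c < (w * swap a b)⁻¹ d ↔ w⁻¹ c < w⁻¹ d := by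
    rw [mul_inv_rev, swap_inv]
    refine swap_lt_iff hab ?_ ?_
    · rintro ⟨e1, e2⟩; exact h1 ⟨by rw [← e1]; simp, by rw [← e2]; simp⟩
    · rintro ⟨e1, e2⟩; exact h2 ⟨by rw [← e2]; simp, by rw [← e1]; simp⟩
  by_cases p1 : w a < w b <;> by_cases p2 : w⁻¹ c < w⁻¹ d <;>
    (simp only [p1, p2, i1, i2, if_true, if_false, map_add, map_smul, leftOp_T, rightOp_T, mul_assoc,
      smul_add]; try module)

variable (F q n) in
/-- The endomorphisms that commute with all right multiplications by the `T_s`. -/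
noncomputable def commutant : Subalgebra F (Module.End F (HeckeAlgebra F q n)) :=
  Subalgebra.centralizer F {f | ∃ a b : Fin n, (a : ℕ) + 1 = b ∧ f = rightOp q a b}

theorem commutant_apply (f : commutant F q n) {a b : Fin n} (hab : (a : ℕ) + 1 = b)
    (x : HeckeAlgebra F q n) : f.1 (rightOp q a b x) = rightOp q a b (f.1 x) :=
  (LinearMap.congr_fun (Subalgebra.mem_centralizer_iff F |>.1 f.2 _ ⟨a, b, hab, rfl⟩) x).symm

variable (F q n) in
/-- Evaluation of such an endomorphism at `T_1`. -/
noncomputable def evalOne : commutant F q n →ₗ[F] HeckeAlgebra F q n where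
  toFun f := f.1 (T q 1)
  map_add' _ _ := rfl
  map_smul' _ _ := rfl

theorem leftOp_mem {a b : Fin n} (hab : (a : ℕ) + 1 = b) : leftOp q a b ∈ commutant F q n := by
  refine (Subalgebra.mem_centralizer_iff F).2 ?_
  rintro _ ⟨c, d, hcd, rfl⟩
  exact LinearMap.ext fun x => (leftOp_rightOp hab hcd x).symm

theorem evalOne_bijective : Function.Bijective (evalOne F q n) := by
  constructor
  · refine (injective_iff_map_eq_zero _).2 fun f hf => ?_
    refine Subtype.ext (hom_ext fun w => ?_)
    refine perm_induction' (P := fun w => f.1 (T q w) = 0) hf ?_ w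
    intro w a b hab hw ih
    have := rightOp_T (q := q) a b w
    rw [if_pos hw] at this
    rw [← this, commutant_apply f hab, ih, map_zero]
  · rw [← LinearMap.range_eq_top, eq_top_iff, ← (basis F q n).span_eq, Submodule.span_le]
    rintro _ ⟨w, rfl⟩
    refine perm_induction (P := fun w => ∃ f, evalOne F q n f = T q w) ⟨1, rfl⟩ ?_ w
    rintro w a b hab hw ⟨f, hf⟩
    refine ⟨⟨leftOp q a b, leftOp_mem hab⟩ * f, ?_⟩
    change leftOp q a b (evalOne F q n f) = _
    rw [hf, leftOp_T, if_pos hw]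

variable (F q n) in
/-- The endomorphisms that commute with right multiplications are the left multiplications. -/
noncomputable def leftMul : HeckeAlgebra F q n ≃ₗ[F] commutant F q n :=
  (LinearEquiv.ofBijective (evalOne F q n) evalOne_bijective).symm

theorem leftMul_one (x : HeckeAlgebra F q n) : (leftMul F q n x).1 (T q 1) = x :=
  (LinearEquiv.ofBijective (evalOne F q n) evalOne_bijective).apply_symm_apply x

theorem leftMul_eq (f : commutant F q n) : leftMul F q n (f.1 (T q 1)) = f :=
  (LinearEquiv.ofBijective (evalOne F q n) evalOne_bijective).symm_apply_apply f

noncomputable instance : Mul (HeckeAlgebra F q n) := ⟨fun x y => (leftMul F q n x).1 y⟩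

noncomputable instance : One (HeckeAlgebra F q n) := ⟨T q 1⟩

theorem mul_def (x y : HeckeAlgebra F q n) : x * y = (leftMul F q n x).1 y := rfl

theorem one_def : (1 : HeckeAlgebra F q n) = T q 1 := rfl

theorem leftMul_mul (x y : HeckeAlgebra F q n) :
    leftMul F q n (x * y) = leftMul F q n x * leftMul F q n y := by
  rw [← leftMul_eq (leftMul F q n x * leftMul F q n y)]
  change leftMul F q n (x * y) =
    leftMul F q n ((leftMul F q n x).1 ((leftMul F q n y).1 (T q 1)))
  rw [leftMul_one]; rfl

noncomputable instance : Ring (HeckeAlgebra F q n) where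
  __ := (inferInstance : AddCommGroup (HeckeAlgebra F q n))
  left_distrib x y z := map_add (leftMul F q n x).1 y z
  right_distrib x y z := by simp only [mul_def, map_add]; rfl
  zero_mul x := by simp only [mul_def, map_zero]; rfl
  mul_zero x := map_zero (leftMul F q n x).1
  mul_assoc x y z := by
    rw [mul_def (x * y), leftMul_mul]; rfl
  one_mul x := by
    have : leftMul F q n (T q 1) = 1 := leftMul_eq (1 : commutant F q n)
    rw [mul_def, one_def, this]; rfl
  mul_one x := leftMul_one x

noncomputable instance : Algebra F (HeckeAlgebra F q n) :=
  Algebra.ofModule (fun r x y => by simp only [mul_def, map_smul]; rfl)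
    (fun r x y => map_smul (leftMul F q n x).1 r y)

theorem mul_T_swap {a b : Fin n} (hab : (a : ℕ) + 1 = b) (x : HeckeAlgebra F q n) :
    x * T q (swap a b) = rightOp q a b x := by
  have h : T q (swap a b) = rightOp q a b (T q 1) := by
    rw [rightOp_T, if_pos (by rw [Fin.lt_def]; simp; omega), mul_one]
  rw [mul_def, h, commutant_apply _ hab, leftMul_one]

theorem T_swap_mul {a b : Fin n} (hab : (a : ℕ) + 1 = b) (x : HeckeAlgebra F q n) :
    T q (swap a b) * x = leftOp q a b x := by
  let f : commutant F q n := ⟨leftOp q a b, leftOp_mem hab⟩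
  have h : T q (swap a b) = f.1 (T q 1) := by
    change _ = leftOp q a b (T q 1)
    rw [leftOp_T, if_pos (by rw [Fin.lt_def]; simp; omega), one_mul]
  rw [mul_def, h, leftMul_eq]

/-- The defining multiplication rule; with permutations acting on the right, `w s` is `s * w`. -/
theorem T_mul_T_of_isSimple (w s : Perm (Fin n)) (hs : IsSimple s) :
    (length (s * w) = length w + 1 → T q w * T q s = T q (s * w)) ∧
    (length (s * w) + 1 = length w → T q w * T q s = q • T q (s * w) + (q - 1) • T q w) := by
  obtain ⟨a, b, hab, rfl⟩ := hs
  rw [mul_T_swap hab, rightOp_T]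
  have hne : w⁻¹ a ≠ w⁻¹ b := fun e => by have := w⁻¹.injective e; subst this; omega
  rcases lt_or_gt_of_ne hne with h | h
  · have := length_swap_mul hab w h
    exact ⟨fun _ => if_pos h, fun h' => by omega⟩
  · have := length_swap_mul hab (swap a b * w) (by simpa using h)
    rw [← mul_assoc, swap_mul_self, one_mul] at this
    exact ⟨fun h' => by omega, fun _ => if_neg (not_lt.2 h.le)⟩

/-- `T_u T_v = T_{uv}` when no inversion of `u` is undone by `v`. -/
theorem T_mul_T (u v : Perm (Fin n)) (h : ∀ i j, i < j → u j < u i → v (u j) < v (u i)) :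
    T q u * T q v = T q (v * u) := by
  induction u using perm_induction' generalizing v with
  | h1 => rw [← one_def, one_mul, mul_one]
  | hs u a b hab hu ih =>
    have hT := mul_T_swap hab (T q u)
    rw [rightOp_T, if_pos hu] at hT
    have hv : v a < v b := by
      have := h _ _ hu (by simp; rw [Fin.lt_def]; omega)
      simpa using this
    rw [← hT, mul_assoc, T_swap_mul hab, leftOp_T, if_pos hv, ih, mul_assoc]
    intro i j hij hlt
    have hne : ¬(u j = a ∧ u i = b) := by
      rintro ⟨rfl, rfl⟩
      simp only [Perm.inv_def, symm_apply_apply] at hu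
      exact absurd hu (not_lt.2 hij.le)
    exact h i j hij (swap_lt_swap hab hlt hne)

end HeckeAlgebra

namespace Hecke

/-! ### Compositions, diagrams and tableaux -/

/-- A composition of `n`: a finitely supported sequence of natural numbers (parts equal to `0` are
allowed) with sum `n`. -/
structure WeakComposition (n : ℕ) where
  /-- The sequence of parts. -/
  parts : ℕ →₀ ℕ
  degree_eq : parts.degree = n

namespace WeakComposition

variable {n : ℕ}

/-- A composition is a partition if its parts weakly decrease. -/
def IsPartition (lam : WeakComposition n) : Prop := Antitone lam.parts

/-- The diagram: the nodes `(i, j)` with `j < lam i`, in lexicographic (reading) order. -/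
noncomputable def diagram (lam : WeakComposition n) : Finset (ℕ ×ₗ ℕ) :=
  (lam.parts.support.sigma fun i => range (lam.parts i)).map
    ⟨fun p => toLex (p.1, p.2), fun p p' h => by
      obtain ⟨a, b⟩ := p
      obtain ⟨c, d⟩ := p'
      simp only [EmbeddingLike.apply_eq_iff_eq, Prod.mk.injEq] at h
      obtain ⟨rfl, rfl⟩ := h
      rfl⟩

/-- The nodes of the diagram. -/
abbrev Node (lam : WeakComposition n) : Type := {x // x ∈ lam.diagram}

variable {lam : WeakComposition n}

/-- The row index of a node. -/
def Node.row (c : lam.Node) : ℕ := (ofLex c.1).1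

/-- The column index of a node. -/
def Node.col (c : lam.Node) : ℕ := (ofLex c.1).2

theorem mem_diagram (i j : ℕ) : toLex (i, j) ∈ lam.diagram ↔ j < lam.parts i := by
  simp only [diagram, mem_map, mem_sigma, Finsupp.mem_support_iff, mem_range]
  constructor
  · rintro ⟨⟨a, b⟩, ⟨-, h⟩, e⟩
    have e' : (a, b) = (i, j) := toLex.injective e
    simp only [Prod.mk.injEq] at e'
    obtain ⟨rfl, rfl⟩ := e'
    exact h
  · intro h
    exact ⟨⟨i, j⟩, ⟨by simp; omega, h⟩, rfl⟩

theorem Node.col_lt (c : lam.Node) : c.col < lam.parts c.row := mem_diagram _ _ |>.1 c.2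

theorem Node.ext_iff {c c' : lam.Node} : c = c' ↔ c.row = c'.row ∧ c.col = c'.col := by
  constructor
  · rintro rfl; exact ⟨rfl, rfl⟩
  · rintro ⟨h1, h2⟩
    exact Subtype.ext (ofLex.injective (Prod.ext h1 h2))

theorem card_diagram (lam : WeakComposition n) : #lam.diagram = n := by
  rw [diagram, card_map, card_sigma]
  simp only [card_range]
  exact lam.degree_eq

/-- The number of nodes in a row whose column index satisfies `P`. -/
theorem card_row (r : ℕ) (P : ℕ → Prop) [DecidablePred P] :
    #{c : lam.Node | c.row = r ∧ P c.col} = #{j ∈ range (lam.parts r) | P j} := by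
  refine card_bij (fun c _ => c.col) ?_ ?_ ?_
  · intro c hc
    simp only [mem_filter, mem_univ, true_and, mem_range] at hc ⊢
    exact ⟨hc.1 ▸ c.col_lt, hc.2⟩
  · intro c hc c' hc' h
    simp only [mem_filter, mem_univ, true_and] at hc hc'
    exact Node.ext_iff.2 ⟨hc.1.trans hc'.1.symm, h⟩
  · intro j hj
    simp only [mem_filter, mem_range] at hj
    exact ⟨⟨toLex (r, j), (mem_diagram _ _).2 hj.1⟩, by simpa using ⟨rfl, hj.2⟩, rfl⟩

/-- The tableau `t^lam`, in which the letters are entered in order along the rows. -/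
noncomputable def initialTableau (lam : WeakComposition n) : lam.Node ≃o Fin n :=
  (lam.diagram.orderIsoOfFin lam.card_diagram).symm

/-- The row of `t^lam` that contains a given letter. -/
noncomputable def rowOf (lam : WeakComposition n) (k : Fin n) : ℕ :=
  (lam.initialTableau.symm k).row

/-- The row stabilizer of `t^lam`. -/
noncomputable def rowStabilizer (lam : WeakComposition n) : Finset (Perm (Fin n)) :=
  {w | ∀ k, lam.rowOf (w k) = lam.rowOf k}

theorem rowOf_monotone (lam : WeakComposition n) : Monotone lam.rowOf := by
  intro k l hkl
  have : lam.initialTableau.symm k ≤ lam.initialTableau.symm l := by simpa using hkl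
  exact Prod.Lex.monotone_fst _ _ this

theorem mem_rowStabilizer {w : Perm (Fin n)} :
    w ∈ lam.rowStabilizer ↔ ∀ k, lam.rowOf (w k) = lam.rowOf k := by simp [rowStabilizer]

theorem card_rowOf (lam : WeakComposition n) (r : ℕ) : #{k | lam.rowOf k = r} = lam.parts r := by
  have h := card_row (lam := lam) r (fun _ => True)
  simp only [and_true, filter_true, card_range] at h
  rw [← h]
  exact card_equiv lam.initialTableau.symm.toEquiv fun k => by
    simp only [mem_filter, mem_univ, true_and]; rfl

end WeakComposition

open WeakComposition

variable {n : ℕ}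

/-- A tableau of shape `lam` and type `mu`: a filling of the diagram of `lam` by natural numbers in
which each `r` occurs `mu r` times. -/
structure Tableau (lam mu : WeakComposition n) where
  /-- The entry at a node. -/
  entry : lam.Node → ℕ
  card_eq : ∀ r, #{c | entry c = r} = mu.parts r

namespace Tableau

variable {lam mu : WeakComposition n}

@[ext] theorem ext {A B : Tableau lam mu} (h : ∀ c, A.entry c = B.entry c) : A = B := by
  obtain ⟨a, _⟩ := A
  obtain ⟨b, _⟩ := B
  obtain rfl : a = b := funext h
  rfl

/-- The entries weakly increase along the rows. -/
def RowStandard (A : Tableau lam mu) : Prop :=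
  ∀ c c' : lam.Node, c.row = c'.row → c.col ≤ c'.col → A.entry c ≤ A.entry c'

/-- Row equivalence: each row contains the same entries, counted with multiplicity. -/
def RowEquiv (A B : Tableau lam mu) : Prop :=
  ∀ i r, #{c | c.row = i ∧ A.entry c = r} = #{c | c.row = i ∧ B.entry c = r}

theorem entry_mem (A : Tableau lam mu) (c : lam.Node) : A.entry c ∈ mu.parts.support := by
  rw [Finsupp.mem_support_iff, ← A.card_eq, Finset.card_ne_zero]
  exact ⟨c, by simp⟩

noncomputable instance : Fintype (Tableau lam mu) :=
  Fintype.ofInjective (fun A c => (⟨A.entry c, A.entry_mem c⟩ : mu.parts.support)) fun _ _ h =>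
    Tableau.ext fun c => congrArg Subtype.val (congrFun h c)

/-- The entries read along the rows: the entry at the place that is occupied by `k` in `t^lam`. -/
noncomputable def word (A : Tableau lam mu) (k : Fin n) : ℕ := A.entry (lam.initialTableau.symm k)

/-- The permutation `1_A`, characterized by `rowOf_perm_symm` and `perm_lt_perm`: in `t^mu 1_A`,
which is row standard, `k` belongs to row `r` if the place occupied by `k` in `t^lam` is occupied
by `r` in `A`. -/
noncomputable def perm (A : Tableau lam mu) : Perm (Fin n) := Tuple.sort A.word

theorem card_word (A : Tableau lam mu) (r : ℕ) : #{k | A.word k = r} = mu.parts r := by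
  rw [← A.card_eq]
  exact card_equiv lam.initialTableau.symm.toEquiv fun k => by
    simp only [mem_filter, mem_univ, true_and]; rfl

theorem word_perm (A : Tableau lam mu) (k : Fin n) : A.word (A.perm k) = mu.rowOf k := by
  have e : ∀ r, Nonempty ({k // A.word k = r} ≃ {k // mu.rowOf k = r}) := fun r => by
    refine Fintype.card_eq.1 ?_
    rw [Fintype.card_subtype, Fintype.card_subtype, A.card_word, mu.card_rowOf]
  let σ : Perm (Fin n) := Equiv.ofFiberEquiv fun r => (e r).some
  have hσ : mu.rowOf ∘ σ = A.word := funext fun k => Equiv.ofFiberEquiv_map _ k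
  have h := Tuple.comp_perm_comp_sort_eq_comp_sort (f := mu.rowOf) (σ := σ)
  rw [hσ, Tuple.sort_eq_refl_iff_monotone.2 mu.rowOf_monotone] at h
  exact congrFun h k

/-- The letter `k` lies in row `A(t^lam⁻¹(k))` of `t^mu 1_A`. -/
theorem rowOf_perm_symm (A : Tableau lam mu) (c : lam.Node) :
    mu.rowOf (A.perm.symm (lam.initialTableau c)) = A.entry c := by
  rw [← A.word_perm]; simp [word]

/-- The tableau `t^mu 1_A` is row standard. -/
theorem perm_lt_perm (A : Tableau lam mu) {i j : Fin n} (hij : i < j)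
    (h : mu.rowOf i = mu.rowOf j) : A.perm i < A.perm j := by
  have := (Tuple.eq_sort_iff (f := A.word) (σ := A.perm)).1 rfl
  exact this.2 i j hij (by rw [A.word_perm, A.word_perm, h])

end Tableau

/-! ### Permutation modules and their homomorphisms -/

variable {F : Type*} [Field F]

open HeckeAlgebra

/-- The element `x_lam`, the sum of the `T_w` over the row stabilizer of `t^lam`. -/
noncomputable def xElt (q : F) (lam : WeakComposition n) : HeckeAlgebra F q n :=
  ∑ w ∈ lam.rowStabilizer, T q w

/-- The permutation module `M^lam`, the right ideal `x_lam H`. -/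
noncomputable def permModule (q : F) (lam : WeakComposition n) :
    Submodule (HeckeAlgebra F q n)ᵐᵒᵖ (HeckeAlgebra F q n) :=
  Submodule.span _ {xElt q lam}

/-- The element `x_mu ∑ T_{1_{A'}}`, summed over the tableaux `A'` that are row equivalent
to `A`. -/
noncomputable def thetaElt (q : F) {lam mu : WeakComposition n} (A : Tableau lam mu) :
    HeckeAlgebra F q n :=
  open Classical in xElt q mu * ∑ A' with Tableau.RowEquiv A' A, T q A'.perm

theorem exists_mul_xElt (q : F) (lam : WeakComposition n) (W : Finset (Perm (Fin n)))
    (hW : ∀ u ∈ lam.rowStabilizer, ∀ w ∈ W, u * w ∈ W) :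
    ∃ h : HeckeAlgebra F q n, ∑ w ∈ W, T q w = h * xElt q lam := by
  induction hk : #W using Nat.strong_induction_on generalizing W with
  | _ k ih =>
    rcases W.eq_empty_or_nonempty with rfl | hne
    · exact ⟨0, by simp⟩
    obtain ⟨w, hw, hmin⟩ := exists_min_image W inv hne
    have adj : ∀ a b : Fin n, (a : ℕ) + 1 = b → lam.rowOf a = lam.rowOf b → w⁻¹ a < w⁻¹ b := by
      intro a b hab hr
      by_contra hlt
      have hn : w⁻¹ a ≠ w⁻¹ b := fun e => by have := w⁻¹.injective e; subst this; omega
      have hlt' : w⁻¹ b < w⁻¹ a := lt_of_le_of_ne (not_lt.1 hlt) hn.symm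
      have hu : swap a b ∈ lam.rowStabilizer := mem_rowStabilizer.2 fun k => by
        rw [swap_apply_def]; split_ifs with h1 h2
        · rw [h1, hr]
        · rw [h2, hr]
        · rfl
      have h1 := hmin _ (hW _ hu _ hw)
      have h2 := length_swap_mul hab (swap a b * w) (by simpa using hlt')
      rw [length_eq_inv, length_eq_inv, ← mul_assoc, swap_mul_self, one_mul] at h2
      omega
    have incr : ∀ m : ℕ, ∀ a b : Fin n, (a : ℕ) + m + 1 = b → lam.rowOf a = lam.rowOf b →
        w⁻¹ a < w⁻¹ b := by
      intro m
      induction m with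
      | zero => exact fun a b hab hr => adj a b hab hr
      | succ m ihm =>
        intro a b hab hr
        have hb := b.2
        let c : Fin n := ⟨a + m + 1, by omega⟩
        have hac : lam.rowOf a = lam.rowOf c :=
          le_antisymm (lam.rowOf_monotone (by rw [Fin.le_def]; simp only [c]; omega))
            (hr ▸ lam.rowOf_monotone (by rw [Fin.le_def]; simp only [c]; omega))
        exact (ihm a c rfl hac).trans (adj c b (by simp only [c]; omega) (hac ▸ hr))
    have hT : ∀ u ∈ lam.rowStabilizer, T q w * T q u = T q (u * w) := by
      intro u hu
      rw [mem_rowStabilizer] at hu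
      refine T_mul_T w u fun i j hij hlt => ?_
      by_contra hle
      rw [not_lt] at hle
      have h1 : lam.rowOf (w j) ≤ lam.rowOf (w i) := lam.rowOf_monotone hlt.le
      have h2 := lam.rowOf_monotone hle
      rw [hu, hu] at h2
      have h3 := incr ((w i : ℕ) - (w j : ℕ) - 1) (w j) (w i)
        (by rw [Fin.lt_def] at hlt; omega) (le_antisymm h1 h2)
      simp only [Perm.inv_def, symm_apply_apply] at h3
      exact absurd h3 (not_lt.2 hij.le)
    have hsub : lam.rowStabilizer.image (· * w) ⊆ W := by
      intro x hx
      obtain ⟨u, hu, rfl⟩ := mem_image.1 hx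
      exact hW u hu w hw
    have hinj : Set.InjOn (· * w) (lam.rowStabilizer : Set (Perm (Fin n))) :=
      fun u _ v _ h => mul_right_cancel h
    have h1 : (1 : Perm (Fin n)) ∈ lam.rowStabilizer := mem_rowStabilizer.2 fun _ => rfl
    obtain ⟨h, hh⟩ := ih _ (by
      rw [← hk]
      refine card_lt_card (sdiff_ssubset hsub ⟨w, mem_image.2 ⟨1, h1, one_mul w⟩⟩))
      (W \ lam.rowStabilizer.image (· * w)) (by
        intro u hu x hx
        rw [mem_sdiff] at hx ⊢
        refine ⟨hW u hu x hx.1, fun hc => hx.2 ?_⟩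
        obtain ⟨v, hv, hvw⟩ := mem_image.1 hc
        refine mem_image.2 ⟨u⁻¹ * v, ?_, ?_⟩
        · rw [mem_rowStabilizer] at hu hv ⊢
          intro k
          rw [← hv k, ← hu ((u⁻¹ * v) k)]
          simp
        · rw [mul_assoc, show v * w = u * x from hvw]; simp) rfl
    refine ⟨h + T q w, ?_⟩
    rw [add_mul, ← hh, ← sum_sdiff hsub, sum_image hinj, xElt, mul_sum,
      sum_congr rfl fun u hu => (hT u hu).symm]

theorem exists_thetaElt_eq (q : F) {lam mu : WeakComposition n} (A : Tableau lam mu) :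
    ∃ h : HeckeAlgebra F q n, thetaElt q A = h * xElt q lam := by
  classical
  let W : Finset (Perm (Fin n)) :=
    {w | ∃ A' : Tableau lam mu, A'.RowEquiv A ∧ ∀ k, A'.word (w k) = mu.rowOf k}
  have hW : thetaElt q A = ∑ w ∈ W, T q w := by
    rw [thetaElt, xElt, sum_mul_sum, ← sum_product']
    refine sum_bij (fun p _ => p.2.perm * p.1) ?_ ?_ ?_ ?_
    · rintro ⟨v, B⟩ h
      simp only [mem_product, mem_filter, mem_univ, true_and, W] at h ⊢
      refine ⟨B, h.2, fun k => ?_⟩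
      rw [Perm.mul_apply, B.word_perm, mem_rowStabilizer.1 h.1]
    · rintro ⟨v, B⟩ h ⟨v', B'⟩ h' e
      simp only [mem_product, mem_filter, mem_univ, true_and] at h h' e
      have hB : B = B' := by
        refine Tableau.ext fun c => ?_
        have h1 := fun k => congrFun (congrArg (fun w : Perm (Fin n) => (w : Fin n → Fin n)) e) k
        let k : Fin n := (B.perm * v)⁻¹ (lam.initialTableau c)
        have hk : (B.perm * v) k = lam.initialTableau c := by simp [k]
        have hk' : (B'.perm * v') k = lam.initialTableau c := by rw [← e, hk]
        have e1 : B.word ((B.perm * v) k) = mu.rowOf k := by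
          rw [Perm.mul_apply, B.word_perm, mem_rowStabilizer.1 h.1]
        have e2 : B'.word ((B'.perm * v') k) = mu.rowOf k := by
          rw [Perm.mul_apply, B'.word_perm, mem_rowStabilizer.1 h'.1]
        rw [hk] at e1
        rw [hk'] at e2
        simpa [Tableau.word] using e1.trans e2.symm
      subst hB
      rw [mul_left_cancel e]
    · intro w hw
      simp only [mem_filter, mem_univ, true_and, W] at hw
      obtain ⟨B, hB, hBw⟩ := hw
      refine ⟨(B.perm⁻¹ * w, B), ?_, by simp⟩
      simp only [mem_product, mem_filter, mem_univ, true_and]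
      refine ⟨mem_rowStabilizer.2 fun k => ?_, hB⟩
      rw [← B.word_perm, ← hBw, Perm.mul_apply, Perm.inv_def, apply_symm_apply]
    · rintro ⟨v, B⟩ h
      simp only [mem_product, mem_filter, mem_univ, true_and] at h ⊢
      have hv := mem_rowStabilizer.1 h.1
      refine T_mul_T v B.perm fun i j hij hlt => B.perm_lt_perm hlt ?_
      refine le_antisymm (mu.rowOf_monotone hlt.le) ?_
      rw [hv, hv]
      exact mu.rowOf_monotone hij.le
  rw [hW]
  refine exists_mul_xElt q lam W ?_
  intro u hu w hw
  simp only [mem_filter, mem_univ, true_and, W] at hw ⊢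
  rw [mem_rowStabilizer] at hu
  obtain ⟨B, hB, hBw⟩ := hw
  let σ : Perm lam.Node :=
    (lam.initialTableau.toEquiv.trans u.symm).trans lam.initialTableau.symm.toEquiv
  have hσ : ∀ c, (σ c).row = c.row := fun c => by
    have := hu (u.symm (lam.initialTableau c))
    simpa [rowOf, σ] using this.symm
  refine ⟨⟨fun c => B.entry (σ c), fun r => ?_⟩, fun i r => ?_, fun k => ?_⟩
  · rw [← B.card_eq]
    exact card_equiv σ (by simp)
  · rw [← hB i r]
    exact card_equiv σ (by simp [hσ])
  · rw [← hBw]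
    simp [Tableau.word, σ]

/-- The homomorphism `Θ_A : M^lam → M^mu`, defined by `x_lam h ↦ (x_mu ∑ T_{1_{A'}}) h`, see
`theta_apply`. It is left multiplication by an element `h'` with
`x_mu ∑ T_{1_{A'}} = h' x_lam`. -/
noncomputable def theta (q : F) {lam mu : WeakComposition n} (A : Tableau lam mu) :
    permModule q lam →ₗ[(HeckeAlgebra F q n)ᵐᵒᵖ] permModule q mu :=
  LinearMap.restrict
    ({ toFun := fun m => (exists_thetaElt_eq q A).choose * m
       map_add' := fun m m' => mul_add _ m m'
       map_smul' := fun h m => (mul_assoc _ m h.unop).symm } :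
      HeckeAlgebra F q n →ₗ[(HeckeAlgebra F q n)ᵐᵒᵖ] HeckeAlgebra F q n) (by
    intro m hm
    obtain ⟨h, rfl⟩ := Submodule.mem_span_singleton.1 hm
    change (exists_thetaElt_eq q A).choose * (xElt q lam * h.unop) ∈ _
    rw [← mul_assoc, ← (exists_thetaElt_eq q A).choose_spec, thetaElt, mul_assoc]
    exact Submodule.mem_span_singleton.2 ⟨op _, rfl⟩)

theorem xElt_mul_mem (q : F) (lam : WeakComposition n) (h : HeckeAlgebra F q n) :
    xElt q lam * h ∈ permModule q lam :=
  Submodule.mem_span_singleton.2 ⟨op h, rfl⟩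

theorem theta_apply (q : F) {lam mu : WeakComposition n} (A : Tableau lam mu)
    (h : HeckeAlgebra F q n) :
    (theta q A ⟨xElt q lam * h, xElt_mul_mem q lam h⟩ : HeckeAlgebra F q n) = thetaElt q A * h := by
  change (exists_thetaElt_eq q A).choose * (xElt q lam * h) = _
  rw [← mul_assoc, ← (exists_thetaElt_eq q A).choose_spec]

/-! ### The maps `ψ_{d,t}` -/

/-- The composition `ν^{d,t}`. -/
noncomputable def nu (mu : WeakComposition n) (d t : ℕ) (ht : t < mu.parts (d + 1)) :
    WeakComposition n where
  parts := (mu.parts.update d (mu.parts d + mu.parts (d + 1) - t)).update (d + 1) t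
  degree_eq := by
    have h : (mu.parts.update d (mu.parts d + mu.parts (d + 1) - t)).update (d + 1) t +
        Finsupp.single (d + 1) (mu.parts (d + 1) - t) =
        mu.parts + Finsupp.single d (mu.parts (d + 1) - t) := by
      ext i
      simp only [Finsupp.add_apply, Finsupp.update_apply, Finsupp.single_apply]
      split_ifs <;> first | omega | (subst_vars; omega)
    have h' := congrArg Finsupp.degree h
    rw [map_add Finsupp.degree, map_add Finsupp.degree, Finsupp.degree_single, Finsupp.degree_single, mu.degree_eq] at h'
    omega

/-- The row standard tableau of shape `mu` and type `ν^{d,t}` whose entries in row `i` are all equal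
to `i`, except that row `d + 1` contains `mu (d + 1) - t` entries equal to `d`, followed by `t`
entries equal to `d + 1`. -/
noncomputable def psiTableau (mu : WeakComposition n) (d t : ℕ) (ht : t < mu.parts (d + 1)) :
    Tableau mu (nu mu d t ht) where
  entry := fun c : mu.Node => if c.row = d + 1 ∧ c.col < mu.parts (d + 1) - t then d else c.row
  card_eq r := by
    have hall : ∀ r, #{c : mu.Node | c.row = r} = mu.parts r := fun r => by
      have := card_row (lam := mu) r (fun _ => True)
      simpa only [and_true, filter_true, card_range] using this
    have h1 : #{c : mu.Node | c.row = d + 1 ∧ c.col < mu.parts (d + 1) - t} =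
        mu.parts (d + 1) - t := by
      rw [card_row (lam := mu) (d + 1) (fun j => j < mu.parts (d + 1) - t)]
      have : ({j ∈ range (mu.parts (d + 1)) | j < mu.parts (d + 1) - t} : Finset ℕ) =
          range (mu.parts (d + 1) - t) := by
        ext j; simp only [mem_filter, mem_range]; omega
      rw [this, card_range]
    have h2 : #{c : mu.Node | c.row = d + 1 ∧ ¬ c.col < mu.parts (d + 1) - t} = t := by
      have := card_filter_add_card_filter_not (s := ({c | c.row = d + 1} : Finset mu.Node))
        (fun c : mu.Node => c.col < mu.parts (d + 1) - t)
      rw [filter_filter, filter_filter, h1, hall] at this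
      omega
    simp only [nu, Finsupp.update_apply]
    split_ifs with e1 e2
    · refine Eq.trans (congrArg card (filter_congr fun c _ => ?_)) h2
      split_ifs <;> omega
    · have hd : Disjoint ({c | c.row = d} : Finset mu.Node)
          ({c | c.row = d + 1 ∧ c.col < mu.parts (d + 1) - t} : Finset mu.Node) := by
        rw [disjoint_filter]; intro c _ h; omega
      have hu := card_union_of_disjoint hd
      rw [hall, h1, ← filter_or] at hu
      rw [Nat.add_sub_assoc ht.le, ← hu]
      refine congrArg card (filter_congr fun c _ => ?_)
      split_ifs <;> omega
    · rw [← hall r]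
      refine congrArg card (filter_congr fun c _ => ?_)
      split_ifs <;> omega

/-- The homomorphism `ψ_{d,t} : M^mu → M^ν`, where `ν = ν^{d,t}`. -/
noncomputable def psi (q : F) (mu : WeakComposition n) (d t : ℕ) (ht : t < mu.parts (d + 1)) :
    permModule q mu →ₗ[(HeckeAlgebra F q n)ᵐᵒᵖ] permModule q (nu mu d t ht) :=
  theta q (psiTableau mu d t ht)

/-! ### Gaussian binomials and the coefficients -/

open Polynomial in
/-- The Gaussian polynomials, see `qFactorial_mul_gaussPoly`. -/
noncomputable def gaussPoly : ℕ → ℕ → ℤ[X]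
  | _, 0 => 1
  | 0, _ + 1 => 0
  | a + 1, b + 1 => gaussPoly a (b + 1) + X ^ (a - b) * gaussPoly a b

open Polynomial in
/-- The polynomial `[a]! = [1][2]⋯[a]`, where `[m] = 1 + X + ⋯ + X ^ (m - 1)`. -/
noncomputable def qFactorial (a : ℕ) : ℤ[X] :=
  ∏ m ∈ range a, ∑ i ∈ range (m + 1), X ^ i

theorem gaussPoly_eq_zero {a b : ℕ} (h : a < b) : gaussPoly a b = 0 := by
  induction a generalizing b with
  | zero => cases b with
    | zero => omega
    | succ b => rfl
  | succ a ih => cases b with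
    | zero => omega
    | succ b => rw [gaussPoly, ih (by omega), ih (by omega)]; simp

open Polynomial in
/-- The defining property `[a choose b] = [a]! / ([b]! [a - b]!)` of Gaussian polynomials. -/
theorem qFactorial_mul_gaussPoly {a b : ℕ} (h : b ≤ a) :
    qFactorial b * qFactorial (a - b) * gaussPoly a b = qFactorial a := by
  induction a generalizing b with
  | zero =>
    obtain rfl : b = 0 := by omega
    simp [gaussPoly, qFactorial]
  | succ a ih =>
    cases b with
    | zero => simp [gaussPoly, qFactorial]
    | succ b =>
      have hsucc : ∀ m, qFactorial (m + 1) = qFactorial m * ∑ i ∈ range (m + 1), (X : ℤ[X]) ^ i :=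
        fun m => prod_range_succ _ _
      rcases (Nat.lt_or_ge b a) with hlt | hge
      · obtain ⟨c, rfl⟩ : ∃ c, a = b + 1 + c := ⟨a - (b + 1), by omega⟩
        have i1 := ih (b := b + 1) (by omega)
        have i2 := ih (b := b) (by omega)
        rw [show b + 1 + c - (b + 1) = c by omega] at i1
        rw [show b + 1 + c - b = c + 1 by omega, hsucc c] at i2
        rw [gaussPoly, show b + 1 + c + 1 - (b + 1) = c + 1 by omega,
          show b + 1 + c - b = c + 1 by omega, hsucc c, hsucc (b + 1 + c)]
        have hs : ∑ i ∈ range (b + 1 + c + 1), (X : ℤ[X]) ^ i = ∑ i ∈ range (c + 1), (X : ℤ[X]) ^ i +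
            X ^ (c + 1) * ∑ i ∈ range (b + 1), (X : ℤ[X]) ^ i := by
          rw [show b + 1 + c + 1 = (c + 1) + (b + 1) by omega, sum_range_add, mul_sum]
          simp [pow_add]
        rw [hs, mul_add (qFactorial (b + 1 + c))]
        nth_rewrite 1 [← i1]
        rw [← i2, hsucc b]
        ring
      · obtain rfl : a = b := by omega
        have i2 := ih (b := a) le_rfl
        rw [gaussPoly, gaussPoly_eq_zero (by omega : a < a + 1)]
        simp only [Nat.sub_self, pow_zero, one_mul, zero_add] at i2 ⊢
        rw [hsucc]
        linear_combination (∑ i ∈ range (a + 1), (X : ℤ[X]) ^ i) * i2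

/-- The Gaussian binomial `[a choose b]` in `F`. -/
noncomputable def gaussBinom (q : F) (a b : ℕ) : F := Polynomial.aeval q (gaussPoly a b)

/-- The set `𝒮` of the row standard tableaux of type `ν^{d,t}` that are obtained by replacing
`mu (d + 1) - t` entries `d + 1` of `A` by `d`. -/
noncomputable def replacements {lam mu : WeakComposition n} (d t : ℕ) (ht : t < mu.parts (d + 1))
    (A : Tableau lam mu) : Finset (Tableau lam (nu mu d t ht)) :=
  open Classical in
  {S | S.RowStandard ∧ #{c | S.entry c ≠ A.entry c} = mu.parts (d + 1) - t ∧
    ∀ c, S.entry c ≠ A.entry c → A.entry c = d + 1 ∧ S.entry c = d}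

/-- The coefficient `b_S = ∏ q ^ (x_i β_i) [y_i choose β_i]`. The product is over the non-empty rows;
for an empty row the factor would be `1`. -/
noncomputable def coeff (q : F) {lam mu nu : WeakComposition n} (d : ℕ) (A : Tableau lam mu)
    (S : Tableau lam nu) : F :=
  ∏ i ∈ lam.parts.support,
    let x : ℕ := #{c | i < c.row ∧ A.entry c = d}
    let y : ℕ := #{c | c.row = i ∧ S.entry c = d}
    let β : ℕ := #{c | c.row = i ∧ S.entry c ≠ A.entry c}
    q ^ (x * β) * gaussBinom q y β

end Hecke

/-!
The permutation module `M^mu` is spanned by the elements `x_mu T_w`, where `w` is the stable sorting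
of a word `f` of content `mu` (`wordElt`): the letter `f k` is the row of `k` in `t^mu w`. A basic
transposition acts by interchanging two adjacent letters, with coefficient `1` at an ascent and with
`q` in place of the interchange at equal letters (`wordElt_mul_T_of_lt`, `wordElt_mul_T_of_eq`). In
these terms `Θ_A (x_lam)` is the sum of the words of the tableaux that are row equivalent to `A`.

The map `ψ_{d,t}` replaces `mu (d + 1) - t` letters `d + 1` of a word by `d` in all possible ways. For
the sorted word all coefficients are `1`. A word `f` is obtained from the sorted one by interchanging
ascents, and such an interchange produces a factor `q` exactly when a replaced letter `d + 1` moves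
before a letter `d`. The replacement at the set of places `U` therefore has the coefficient
`q ^ c`, where `c` is the number of pairs of a place in `U` and a later letter `d` of `f`
(`crossings`, `thetaElt_psiTableau_mul_T_sort`).

To find the coefficient of a word `B` in `ψ_{d,t} Θ_A (x_lam)`, one sums `q ^ c` over the sets `U` of
letters `d` of `B` that have prescribed numbers `β_i` of elements in the rows. The pairs in different
rows contribute `∑ x_i β_i` to `c`, and within a row the sum over the `β_i`-subsets of the `y_i`
letters `d` is the Gaussian binomial (`sum_pow_crossings`, `sum_pow_crossings_rows`). The result is
the coefficient `b_S` of the unique row standard tableau `S` that is row equivalent to `B`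
(`coeff_eq_sum_raisings`, `sum_wordElt_setLetter`).
-/

namespace Hecke

open HeckeAlgebra WeakComposition

variable {n : ℕ}

/-! ### Words -/

/-- The word `f` has content `mu`: each letter `r` occurs `mu r` times. -/
def HasContent (f : Fin n → ℕ) (mu : WeakComposition n) : Prop :=
  ∀ r, #{k | f k = r} = mu.parts r

/-- The tableau of shape `lam` that is obtained by entering a word along the rows. -/
noncomputable def Tableau.ofWord (lam : WeakComposition n) {mu : WeakComposition n} (f : Fin n → ℕ)
    (hf : HasContent f mu) : Tableau lam mu where
  entry c := f (lam.initialTableau c)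
  card_eq r := by
    rw [← hf r]
    exact card_equiv lam.initialTableau.toEquiv fun c => by
      simp only [mem_filter, mem_univ, true_and]; rfl

@[simp] theorem Tableau.word_ofWord (lam : WeakComposition n) {mu : WeakComposition n}
    (f : Fin n → ℕ) (hf : HasContent f mu) : (Tableau.ofWord lam f hf).word = f := by
  funext k; simp [Tableau.word, Tableau.ofWord]

theorem Tableau.word_initialTableau {lam mu : WeakComposition n} (A : Tableau lam mu)
    (c : lam.Node) : A.word (lam.initialTableau c) = A.entry c := by
  simp [Tableau.word]

theorem Tableau.hasContent_word {lam mu : WeakComposition n} (A : Tableau lam mu) :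
    HasContent A.word mu := A.card_word

theorem Tableau.word_injective {lam mu : WeakComposition n} :
    Function.Injective (Tableau.word : Tableau lam mu → Fin n → ℕ) := fun A B h =>
  Tableau.ext fun c => by rw [← A.word_initialTableau, h, B.word_initialTableau]

theorem HasContent.apply_sort {mu : WeakComposition n} {f : Fin n → ℕ} (hf : HasContent f mu)
    (k : Fin n) : f (Tuple.sort f k) = mu.rowOf k := by
  have h := (Tableau.ofWord mu f hf).word_perm k
  rwa [Tableau.perm, Tableau.word_ofWord] at h

theorem HasContent.comp_perm {mu : WeakComposition n} {f : Fin n → ℕ} (hf : HasContent f mu)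
    (σ : Perm (Fin n)) : HasContent (f ∘ σ) mu := fun r => by
  rw [← hf r]
  exact card_equiv σ (by simp)

theorem sort_apply_sort_inv (f : Fin n → ℕ) (k : Fin n) :
    Tuple.sort f ((Tuple.sort f)⁻¹ k) = k := by simp

theorem sort_lt_sort {f : Fin n → ℕ} {i j : Fin n} (hij : i < j)
    (h : f (Tuple.sort f i) = f (Tuple.sort f j)) : Tuple.sort f i < Tuple.sort f j :=
  ((Tuple.eq_sort_iff (f := f)).1 rfl).2 i j hij h

theorem sort_inv_lt_sort_inv {f : Fin n → ℕ} {k l : Fin n} (h : f k < f l) :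
    (Tuple.sort f)⁻¹ k < (Tuple.sort f)⁻¹ l := by
  by_contra hle
  have := Tuple.monotone_sort f (not_lt.1 hle)
  simp only [Function.comp_apply, sort_apply_sort_inv] at this
  omega

theorem sort_inv_lt_sort_inv_of_eq {f : Fin n → ℕ} {k l : Fin n} (h : f k = f l) (hkl : k < l) :
    (Tuple.sort f)⁻¹ k < (Tuple.sort f)⁻¹ l := by
  by_contra hle
  have hne : (Tuple.sort f)⁻¹ l ≠ (Tuple.sort f)⁻¹ k := fun e =>
    hkl.ne' ((Tuple.sort f)⁻¹.injective e)
  have := sort_lt_sort (f := f) (lt_of_le_of_ne (not_lt.1 hle) hne)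
    (by simp only [sort_apply_sort_inv, h])
  simp only [sort_apply_sort_inv] at this
  exact absurd this (not_lt.2 hkl.le)

theorem sort_comp_swap {a b : Fin n} (hab : (a : ℕ) + 1 = b) {f : Fin n → ℕ} (h : f a ≠ f b) :
    Tuple.sort (f ∘ swap a b) = swap a b * Tuple.sort f := by
  symm
  rw [Tuple.eq_sort_iff]
  have e : (f ∘ swap a b) ∘ (swap a b * Tuple.sort f) = f ∘ Tuple.sort f := by
    funext k; simp
  refine ⟨e ▸ Tuple.monotone_sort f, fun i j hij hf => ?_⟩
  simp only [Function.comp_apply, Perm.coe_mul, swap_apply_self] at hf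
  refine swap_lt_swap hab (sort_lt_sort hij hf) ?_
  rintro ⟨h1, h2⟩
  rw [h1, h2] at hf
  exact h hf

/-- Adjacent places with equal letters are adjacent in the stable sorting of a word. -/
theorem sort_inv_add_one {a b : Fin n} (hab : (a : ℕ) + 1 = b) {f : Fin n → ℕ} (h : f a = f b) :
    ((Tuple.sort f)⁻¹ a : ℕ) + 1 = (Tuple.sort f)⁻¹ b := by
  have hlt := sort_inv_lt_sort_inv_of_eq h (by rw [Fin.lt_def]; omega : a < b)
  by_contra hne
  have hb := ((Tuple.sort f)⁻¹ b).2
  rw [Fin.lt_def] at hlt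
  obtain ⟨k, hk⟩ : ∃ k : Fin n, (k : ℕ) = ((Tuple.sort f)⁻¹ a : ℕ) + 1 := ⟨⟨_, by omega⟩, rfl⟩
  have h1 : (Tuple.sort f)⁻¹ a < k := by rw [Fin.lt_def]; omega
  have h2 : k < (Tuple.sort f)⁻¹ b := by rw [Fin.lt_def]; omega
  have m1 := Tuple.monotone_sort f h1.le
  have m2 := Tuple.monotone_sort f h2.le
  simp only [Function.comp_apply, sort_apply_sort_inv] at m1 m2
  have l1 := sort_lt_sort (f := f) h1 (by rw [sort_apply_sort_inv]; omega)
  have l2 := sort_lt_sort (f := f) h2 (by rw [sort_apply_sort_inv]; omega)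
  rw [sort_apply_sort_inv, Fin.lt_def] at l1 l2
  omega

/-! ### The action on the word basis of a permutation module -/

variable {F : Type*} [Field F]

theorem swap_mem_rowStabilizer {lam : WeakComposition n} {a b : Fin n}
    (h : lam.rowOf a = lam.rowOf b) : swap a b ∈ lam.rowStabilizer :=
  mem_rowStabilizer.2 fun k => by
    rw [swap_apply_def]; split_ifs with h1 h2
    · rw [h1, h]
    · rw [h2, h]
    · rfl

/-- `x_lam T_s = q x_lam` for the basic transpositions `s` in the row stabilizer. -/
theorem xElt_mul_T_swap (q : F) {lam : WeakComposition n} {a b : Fin n} (hab : (a : ℕ) + 1 = b)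
    (h : lam.rowOf a = lam.rowOf b) : xElt q lam * T q (swap a b) = q • xElt q lam := by
  classical
  have hs := mem_rowStabilizer.1 (swap_mem_rowStabilizer h)
  have hne : ∀ w : Perm (Fin n), w⁻¹ a ≠ w⁻¹ b := fun w e => by
    have := w⁻¹.injective e; subst this; omega
  have hinv : ∀ w : Perm (Fin n), (swap a b * w)⁻¹ a = w⁻¹ b ∧ (swap a b * w)⁻¹ b = w⁻¹ a :=
    fun w => by simp
  -- left multiplication by `s` pairs the `w` with `w⁻¹ a < w⁻¹ b` with the others
  have flip : ∀ g : Perm (Fin n) → HeckeAlgebra F q n,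
      ∑ w ∈ lam.rowStabilizer with w⁻¹ a < w⁻¹ b, g (swap a b * w) =
        ∑ w ∈ lam.rowStabilizer with ¬ w⁻¹ a < w⁻¹ b, g w := fun g => by
    refine sum_nbij' (swap a b * ·) (swap a b * ·) ?_ ?_ ?_ ?_ (fun _ _ => rfl)
    · intro w hw
      simp only [mem_filter, mem_rowStabilizer, hinv] at hw ⊢
      exact ⟨fun k => by rw [Perm.mul_apply, hs, hw.1], not_lt.2 hw.2.le⟩
    · intro w hw
      simp only [mem_filter, mem_rowStabilizer, hinv] at hw ⊢
      exact ⟨fun k => by rw [Perm.mul_apply, hs, hw.1],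
        lt_of_le_of_ne (not_lt.1 hw.2) (hne w).symm⟩
    · intro w _; simp [← mul_assoc]
    · intro w _; simp [← mul_assoc]
  have f1 := flip (T q)
  have f2 := flip fun w => T q (swap a b * w)
  simp only [← mul_assoc, swap_mul_self, one_mul] at f2
  have hsplit := sum_filter_add_sum_filter_not lam.rowStabilizer
    (fun w : Perm (Fin n) => w⁻¹ a < w⁻¹ b) (T q)
  rw [mul_T_swap hab, xElt, map_sum]
  simp only [rightOp_T]
  rw [sum_ite, sum_add_distrib, ← smul_sum, ← smul_sum, f1, ← f2, ← hsplit]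
  module

/-- The basis element of the permutation module `M^mu` that corresponds to a word of content `mu`. -/
noncomputable def wordElt (q : F) (mu : WeakComposition n) (f : Fin n → ℕ) : HeckeAlgebra F q n :=
  xElt q mu * T q (Tuple.sort f)

theorem T_sort_mul_T_swap (q : F) {a b : Fin n} (hab : (a : ℕ) + 1 = b) {f : Fin n → ℕ}
    (h : f a < f b) : T q (Tuple.sort f) * T q (swap a b) = T q (Tuple.sort (f ∘ swap a b)) := by
  rw [mul_T_swap hab, rightOp_T, if_pos (sort_inv_lt_sort_inv h), sort_comp_swap hab h.ne]

/-- The letters of an ascent are interchanged with coefficient `1`: the length of the sorting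
permutation increases. -/
theorem wordElt_mul_T_of_lt (q : F) (mu : WeakComposition n) {a b : Fin n}
    (hab : (a : ℕ) + 1 = b) {f : Fin n → ℕ} (h : f a < f b) :
    wordElt q mu f * T q (swap a b) = wordElt q mu (f ∘ swap a b) := by
  rw [wordElt, mul_assoc, T_sort_mul_T_swap q hab h, wordElt]

/-- Equal adjacent letters give the factor `q`: the transposition moves past the sorting permutation
into the row stabilizer of `t^mu`. -/
theorem wordElt_mul_T_of_eq (q : F) {mu : WeakComposition n} {a b : Fin n}
    (hab : (a : ℕ) + 1 = b) {f : Fin n → ℕ} (hf : HasContent f mu) (h : f a = f b) :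
    wordElt q mu f * T q (swap a b) = q • wordElt q mu f := by
  have hij := sort_inv_add_one hab h
  have hlt := sort_inv_lt_sort_inv_of_eq h (by rw [Fin.lt_def]; omega : a < b)
  have e : swap a b * Tuple.sort f =
      Tuple.sort f * swap ((Tuple.sort f)⁻¹ a) ((Tuple.sort f)⁻¹ b) := by
    rw [mul_swap_eq_swap_mul, sort_apply_sort_inv, sort_apply_sort_inv]
  have hT : T q (Tuple.sort f) * T q (swap a b) =
      T q (swap ((Tuple.sort f)⁻¹ a) ((Tuple.sort f)⁻¹ b)) * T q (Tuple.sort f) := by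
    rw [mul_T_swap hab, rightOp_T, if_pos hlt, T_swap_mul hij, leftOp_T, if_pos, e]
    simpa only [sort_apply_sort_inv, Fin.lt_def] using (by omega : (a : ℕ) < b)
  rw [wordElt, mul_assoc, hT, ← mul_assoc, xElt_mul_T_swap q hij, smul_mul_assoc]
  rw [← hf.apply_sort, ← hf.apply_sort, sort_apply_sort_inv, sort_apply_sort_inv, h]

/-! ### Lowering letters of a word -/

/-- The word obtained from `f` by writing `d` at the places in `U`. -/
def setLetter (d : ℕ) (U : Finset (Fin n)) (f : Fin n → ℕ) (k : Fin n) : ℕ :=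
  if k ∈ U then d else f k

/-- The number of pairs `k < l` with `k ∈ U` and `l ∈ V`. -/
def crossings {α : Type*} [LinearOrder α] (U V : Finset α) : ℕ :=
  #{p ∈ U ×ˢ V | p.1 < p.2}

/-- Letter counts, inside a set `Q` of places, when the letters `d + 1` at the places in `U` are
replaced by `d`. -/
theorem card_setLetter {d : ℕ} {U : Finset (Fin n)} {f : Fin n → ℕ} (hU : ∀ k ∈ U, f k = d + 1)
    (Q : Fin n → Prop) [DecidablePred Q] (r : ℕ) :
    #{k | Q k ∧ setLetter d U f k = r} + (if r = d + 1 then #{k ∈ U | Q k} else 0) =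
      #{k | Q k ∧ f k = r} + (if r = d then #{k ∈ U | Q k} else 0) := by
  have hUQ : #{k ∈ U | Q k} = #{k | Q k ∧ k ∈ U} := by
    congr 1; ext k; simp [and_comm]
  rw [hUQ]
  have e : ∀ s : ℕ, (if r = s then #{k | Q k ∧ k ∈ U} else 0) =
      #{k | Q k ∧ k ∈ U ∧ r = s} := fun s => by split_ifs with h <;> simp [h]
  rw [e, e]
  simp only [card_filter, ← sum_add_distrib]
  refine sum_congr rfl fun k _ => ?_
  by_cases hk : k ∈ U
  · have := hU k hk
    by_cases hQ : Q k
    · simp only [setLetter, hk, hQ, this, true_and, if_true]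
      split_ifs <;> omega
    · simp [hQ]
  · simp [setLetter, hk]

theorem setLetter_setLetter {d e : ℕ} {U : Finset (Fin n)} {f : Fin n → ℕ}
    (hU : ∀ k ∈ U, f k = d) : setLetter d U (setLetter e U f) = f := by
  funext k
  by_cases hk : k ∈ U
  · simp [setLetter, hk, hU k hk]
  · simp [setLetter, hk]

theorem nu_parts_add {mu : WeakComposition n} {d t : ℕ} (ht : t < mu.parts (d + 1)) (r : ℕ) :
    (nu mu d t ht).parts r + (if r = d + 1 then mu.parts (d + 1) - t else 0) =
      mu.parts r + (if r = d then mu.parts (d + 1) - t else 0) := by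
  simp only [nu, Finsupp.update_apply]
  split_ifs <;> first | omega | (subst_vars; omega)

theorem hasContent_setLetter {mu : WeakComposition n} {d t : ℕ} (ht : t < mu.parts (d + 1))
    {U : Finset (Fin n)} {f : Fin n → ℕ} (hU : ∀ k ∈ U, f k = d + 1)
    (hc : #U = mu.parts (d + 1) - t) :
    HasContent (setLetter d U f) (nu mu d t ht) ↔ HasContent f mu := by
  refine forall_congr' fun r => ?_
  have h := card_setLetter hU (fun _ => True) r
  simp only [true_and, filter_true, hc] at h
  have h' := nu_parts_add ht r
  omega

/-! ### Row equivalence of words -/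

/-- Two words, entered along the rows of the diagram of `lam`, have the same letters in each row,
counted with multiplicity. -/
def SameRows (lam : WeakComposition n) (f g : Fin n → ℕ) : Prop :=
  ∀ i r, #{k | lam.rowOf k = i ∧ f k = r} = #{k | lam.rowOf k = i ∧ g k = r}

theorem card_node_eq {lam : WeakComposition n} (P : lam.Node → Prop) [DecidablePred P] :
    #{c | P c} = #{k | P (lam.initialTableau.symm k)} :=
  card_equiv lam.initialTableau.toEquiv fun c => by simp

theorem Tableau.rowEquiv_iff {lam mu : WeakComposition n} {A B : Tableau lam mu} :
    A.RowEquiv B ↔ SameRows lam A.word B.word := by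
  refine forall_congr' fun i => forall_congr' fun r => ?_
  rw [card_node_eq, card_node_eq]
  rfl

theorem sameRows_setLetter {lam : WeakComposition n} {d : ℕ} {U V : Finset (Fin n)}
    {f g : Fin n → ℕ} (hU : ∀ k ∈ U, f k = d + 1) (hV : ∀ k ∈ V, g k = d + 1)
    (h : ∀ i, #{k ∈ U | lam.rowOf k = i} = #{k ∈ V | lam.rowOf k = i}) :
    SameRows lam (setLetter d U f) (setLetter d V g) ↔ SameRows lam f g := by
  refine forall_congr' fun i => forall_congr' fun r => ?_
  have h1 := card_setLetter hU (fun k => lam.rowOf k = i) r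
  have h2 := card_setLetter hV (fun k => lam.rowOf k = i) r
  rw [h i] at h1
  omega

theorem rowOf_mem_support (lam : WeakComposition n) (k : Fin n) :
    lam.rowOf k ∈ lam.parts.support := by
  rw [Finsupp.mem_support_iff, ← lam.card_rowOf, Finset.card_ne_zero]
  exact ⟨k, by simp⟩

theorem card_eq_sum_rows (lam : WeakComposition n) (X : Finset (Fin n)) :
    #X = ∑ i ∈ lam.parts.support, #{k ∈ X | lam.rowOf k = i} :=
  card_eq_sum_card_fiberwise fun k _ => rowOf_mem_support lam k

open Classical in
theorem thetaElt_eq_sum_wordElt (q : F) {lam mu : WeakComposition n} (A : Tableau lam mu) :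
    thetaElt q A =
      ∑ A' : Tableau lam mu with A'.RowEquiv A, wordElt q mu A'.word := by
  rw [thetaElt, mul_sum]
  rfl

/-! ### The map `ψ_{d,t}` on the word basis -/

/-- The tableaux that are row equivalent to the tableau defining `ψ_{d,t}` have entry `i` in row `i`,
except for `mu (d + 1) - t` entries `d` in row `d + 1`. -/
theorem exists_setLetter_of_rowEquiv_psiTableau {mu : WeakComposition n} {d t : ℕ}
    (ht : t < mu.parts (d + 1)) {B : Tableau mu (nu mu d t ht)}
    (hB : B.RowEquiv (psiTableau mu d t ht)) :
    ∃ U ∈ powersetCard (mu.parts (d + 1) - t) {k | mu.rowOf k = d + 1},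
      B.word = setLetter d U mu.rowOf := by
  have key : ∀ c : mu.Node, B.entry c = c.row ∨ B.entry c = d ∧ c.row = d + 1 := by
    intro c
    have hpos : #{c' : mu.Node | c'.row = c.row ∧ B.entry c' = B.entry c} ≠ 0 :=
      Finset.card_ne_zero.2 ⟨c, by simp⟩
    rw [hB] at hpos
    obtain ⟨c', hc'⟩ := Finset.card_ne_zero.1 hpos
    replace hc' := (mem_filter.1 hc').2
    simp only [psiTableau] at hc'
    split_ifs at hc' <;> omega
  have key' : ∀ k, B.word k = mu.rowOf k ∨ B.word k = d ∧ mu.rowOf k = d + 1 := fun k => key _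
  refine ⟨({k | mu.rowOf k = d + 1 ∧ B.word k = d} : Finset (Fin n)), ?_, ?_⟩
  · rw [mem_powersetCard]
    refine ⟨fun k => by simp +contextual, ?_⟩
    rw [Tableau.rowEquiv_iff.1 hB (d + 1) d]
    have h := card_row (lam := mu) (d + 1) (fun j => j < mu.parts (d + 1) - t)
    have e : ({j ∈ range (mu.parts (d + 1)) | j < mu.parts (d + 1) - t} : Finset ℕ) =
        range (mu.parts (d + 1) - t) := by
      ext j; simp only [mem_filter, mem_range]; omega
    rw [e, card_range, card_node_eq] at h
    rw [← h]
    refine congrArg card (filter_congr fun k _ => and_congr_right fun hk => ?_)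
    have hk' : (mu.initialTableau.symm k).row = d + 1 := hk
    simp only [Tableau.word, psiTableau, hk', true_and]
    split_ifs <;> simp_all
  · funext k
    rcases key' k with h | h
    · simp only [setLetter, mem_filter, mem_univ, true_and, h]
      split_ifs <;> omega
    · simp [setLetter, h]

theorem card_filter_rowOf_of_mem_powersetCard {mu : WeakComposition n} {r m i : ℕ}
    {U : Finset (Fin n)} (hU : U ∈ powersetCard m {k | mu.rowOf k = r}) :
    #{k ∈ U | mu.rowOf k = i} = if i = r then m else 0 := by
  rw [mem_powersetCard] at hU
  have hU' : ∀ k ∈ U, mu.rowOf k = r := fun k hk => by simpa using hU.1 hk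
  split_ifs with h
  · rw [filter_true_of_mem fun k hk => (hU' k hk).trans h.symm, hU.2]
  · rw [filter_false_of_mem fun k hk => by rw [hU' k hk]; exact Ne.symm h, card_empty]

theorem crossings_rowOf {mu : WeakComposition n} {d : ℕ} {U : Finset (Fin n)}
    (hU : ∀ k ∈ U, mu.rowOf k = d + 1) : crossings U {k | mu.rowOf k = d} = 0 := by
  rw [crossings, card_eq_zero, filter_eq_empty_iff]
  rintro ⟨k, l⟩ hkl hlt
  simp only [mem_product, mem_filter, mem_univ, true_and] at hkl hlt
  have h1 := hU k hkl.1
  have h2 := mu.rowOf_monotone hlt.le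
  omega

/-- The value of `ψ_{d,t}` at the generator `x_mu`, the basis element of the sorted word. -/
theorem thetaElt_psiTableau (q : F) (mu : WeakComposition n) (d t : ℕ)
    (ht : t < mu.parts (d + 1)) :
    thetaElt q (psiTableau mu d t ht) =
      ∑ U ∈ powersetCard (mu.parts (d + 1) - t) {k | mu.rowOf k = d + 1},
        wordElt q (nu mu d t ht) (setLetter d U mu.rowOf) := by
  classical
  have sub : ∀ U ∈ powersetCard (mu.parts (d + 1) - t) {k | mu.rowOf k = d + 1},
      ∀ k ∈ U, mu.rowOf k = d + 1 := fun U hU k hk => by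
    simpa using (mem_powersetCard.1 hU).1 hk
  have cont : ∀ U ∈ powersetCard (mu.parts (d + 1) - t) {k | mu.rowOf k = d + 1},
      HasContent (setLetter d U mu.rowOf) (nu mu d t ht) := fun U hU =>
    (hasContent_setLetter ht (sub U hU) (mem_powersetCard.1 hU).2).2 mu.card_rowOf
  rw [thetaElt_eq_sum_wordElt]
  symm
  refine sum_bij (fun U hU => Tableau.ofWord mu _ (cont U hU)) ?_ ?_ ?_ ?_
  · intro U hU
    obtain ⟨V, hV, hVe⟩ := exists_setLetter_of_rowEquiv_psiTableau ht
      (B := psiTableau mu d t ht) fun _ _ => rfl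
    rw [mem_filter_univ, Tableau.rowEquiv_iff, Tableau.word_ofWord, hVe,
      sameRows_setLetter (sub U hU) (sub V hV)]
    · exact fun _ _ => rfl
    · intro i
      rw [card_filter_rowOf_of_mem_powersetCard hU, card_filter_rowOf_of_mem_powersetCard hV]
  · intro U hU V hV e
    have e' : setLetter d U mu.rowOf = setLetter d V mu.rowOf := by
      simpa using congrArg Tableau.word e
    ext k
    have h := congrFun e' k
    have h1 := sub U hU k
    have h2 := sub V hV k
    simp only [setLetter] at h
    by_cases hk : k ∈ U <;> by_cases hk' : k ∈ V <;> simp_all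
  · intro B hB
    obtain ⟨U, hU, hUe⟩ := exists_setLetter_of_rowEquiv_psiTableau ht (mem_filter.1 hB).2
    exact ⟨U, hU, Tableau.word_injective (by rw [Tableau.word_ofWord, hUe])⟩
  · intro U hU
    rw [Tableau.word_ofWord]

/-- Interchanging adjacent places `a`, `b` of a word affects the crossings through the pair `(b, a)`
only. -/
theorem crossings_map_swap {a b : Fin n} (hab : (a : ℕ) + 1 = b) (U V : Finset (Fin n))
    (h : ¬ (a ∈ U ∧ b ∈ V)) :
    crossings (U.map (swap a b).toEmbedding) (V.map (swap a b).toEmbedding) =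
      crossings U V + if b ∈ U ∧ a ∈ V then 1 else 0 := by
  have hlt : a < b := by rw [Fin.lt_def]; omega
  have e : crossings (U.map (swap a b).toEmbedding) (V.map (swap a b).toEmbedding) =
      #{p ∈ U ×ˢ V | swap a b p.1 < swap a b p.2} := by
    refine card_equiv ((swap a b).prodCongr (swap a b)) fun p => ?_
    simp
  rw [e]
  have e2 : #{p ∈ U ×ˢ V | swap a b p.1 < swap a b p.2 ∧ ¬ p = (b, a)} = crossings U V := by
    refine congrArg card (filter_congr ?_)
    rintro ⟨k, l⟩ hkl
    rw [mem_product] at hkl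
    rw [Prod.mk.injEq]
    have h1 : ¬ (k = a ∧ l = b) := by
      rintro ⟨rfl, rfl⟩; exact h hkl
    by_cases h2 : k = b ∧ l = a
    · simp only [h2, not_true_eq_false, and_false, and_self, false_iff, not_lt]
      exact hlt.le
    · simp only [h2, not_false_eq_true, and_true]
      exact swap_lt_iff hab h1 h2
  rw [← e2, ← card_filter_add_card_filter_not (fun p => p = (b, a)), filter_filter, filter_filter,
    add_comm]
  congr 1
  split_ifs with hc
  · rw [card_eq_one]
    refine ⟨(b, a), ?_⟩
    ext p
    simp only [mem_filter, mem_product, mem_singleton]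
    refine ⟨fun hp => hp.2.2, ?_⟩
    rintro rfl
    simpa [hlt] using hc
  · rw [card_eq_zero, filter_eq_empty_iff]
    rintro p hp ⟨-, rfl⟩
    exact hc (mem_product.1 hp)

theorem setLetter_comp_perm (d : ℕ) (U : Finset (Fin n)) (f : Fin n → ℕ) (σ : Perm (Fin n)) :
    setLetter d (U.map σ.symm.toEmbedding) (f ∘ σ) = setLetter d U f ∘ σ := by
  funext k
  simp [setLetter]

/-- The image under `ψ_{d,t}` of the basis element of `M^mu` that corresponds to the word `f`: the
letters `d + 1` at the places in `U` become `d`, at the cost of a factor `q` for each pair of a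
changed place and a later letter `d`. -/
theorem thetaElt_psiTableau_mul_T_sort (q : F) {mu : WeakComposition n} {d t : ℕ}
    (ht : t < mu.parts (d + 1)) {f : Fin n → ℕ} (hf : HasContent f mu) :
    thetaElt q (psiTableau mu d t ht) * T q (Tuple.sort f) =
      ∑ U ∈ powersetCard (mu.parts (d + 1) - t) {k | f k = d + 1},
        q ^ crossings U {k | f k = d} • wordElt q (nu mu d t ht) (setLetter d U f) := by
  induction hw : Tuple.sort f using perm_induction' generalizing f with
  | h1 =>
    have e : f = mu.rowOf := funext fun k => by
      rw [← hf.apply_sort, hw, Perm.one_apply]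
    subst e
    rw [← HeckeAlgebra.one_def, mul_one, thetaElt_psiTableau]
    refine sum_congr rfl fun U hU => ?_
    rw [crossings_rowOf fun k hk => by simpa using (mem_powersetCard.1 hU).1 hk, pow_zero, one_smul]
  | hs w a b hab hlt ih =>
    have hablt : a < b := by rw [Fin.lt_def]; omega
    -- `f` has a descent at `a`, so that it arises from `g = f ∘ (a b)` by an ascending step
    have hfab : f b < f a := by
      have h1 : (Tuple.sort f)⁻¹ b < (Tuple.sort f)⁻¹ a := by
        rw [hw]; simpa using hlt
      have h2 := Tuple.monotone_sort f h1.le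
      simp only [Function.comp_apply, sort_apply_sort_inv] at h2
      refine lt_of_le_of_ne h2 fun e => ?_
      exact absurd (sort_inv_lt_sort_inv_of_eq e.symm hablt) (not_lt.2 h1.le)
    obtain ⟨g, rfl⟩ : ∃ g, f = g ∘ swap a b := ⟨f ∘ swap a b, by funext k; simp⟩
    simp only [Function.comp_apply, swap_apply_left, swap_apply_right] at hfab
    have hg : HasContent g mu := by
      have := hf.comp_perm (swap a b)
      rwa [Function.comp_assoc, ← Perm.coe_mul, swap_mul_self, Perm.coe_one,
        Function.comp_id] at this
    have hgw : Tuple.sort g = w := by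
      rw [sort_comp_swap hab hfab.ne] at hw
      exact mul_left_cancel hw
    rw [← hw, ← T_sort_mul_T_swap q hab hfab, ← mul_assoc, hgw, ih hg hgw, sum_mul]
    refine sum_nbij' (fun U => U.map (swap a b).toEmbedding)
      (fun U => U.map (swap a b).toEmbedding) ?_ ?_ ?_ ?_ ?_
    · intro U hU
      rw [mem_powersetCard] at hU ⊢
      refine ⟨fun k hk => ?_, by rw [card_map, hU.2]⟩
      have := hU.1 ((mem_map_equiv).1 hk)
      simpa using this
    · intro U hU
      rw [mem_powersetCard] at hU ⊢
      refine ⟨fun k hk => ?_, by rw [card_map, hU.2]⟩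
      have := hU.1 ((mem_map_equiv).1 hk)
      simpa using this
    · intro U _; ext k; simp
    · intro U _; ext k; simp
    · intro U hU
      rw [mem_powersetCard] at hU
      have hU' : ∀ k ∈ U, g k = d + 1 := fun k hk => by simpa using hU.1 hk
      have e1 : setLetter d (U.map (swap a b).toEmbedding) (g ∘ swap a b) =
          setLetter d U g ∘ swap a b := by
        simpa using setLetter_comp_perm d U g (swap a b)
      have e2 : ({k | (g ∘ swap a b) k = d} : Finset (Fin n)) =
          ({k | g k = d} : Finset (Fin n)).map (swap a b).toEmbedding := by
        ext k; simp [mem_map_equiv]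
      rw [e1, e2, crossings_map_swap hab, smul_mul_assoc]
      · simp only [mem_filter, mem_univ, true_and]
        split_ifs with hc
        · -- the two letters become equal, and `U` gains the crossing of `a` and `b`
          have heq : setLetter d U g a = setLetter d U g b := by
            simp only [setLetter, hc.1, hc.2, if_true, ite_self]
          have hid : setLetter d U g ∘ swap a b = setLetter d U g := by
            funext k
            rw [Function.comp_apply, swap_apply_def]
            split_ifs with h1 h2
            · rw [h1, heq]
            · rw [h2, heq]
            · rfl
          rw [hid, wordElt_mul_T_of_eq q hab ((hasContent_setLetter ht hU' hU.2).2 hg) heq,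
            smul_smul, pow_succ]
        · -- the ascent of `g` remains an ascent
          rw [wordElt_mul_T_of_lt q _ hab, add_zero]
          simp only [setLetter]
          have ha := hU' a
          have hb := hU' b
          split_ifs with h1 h2 h2
          · have := ha h1; have := hb h2; omega
          · have := ha h1; omega
          · have := hb h2
            have : g a ≠ d := fun e => hc ⟨h2, e⟩
            omega
          · exact hfab
      · rintro ⟨h1, h2⟩
        have := hU' a h1
        simp only [mem_filter, mem_univ, true_and] at h2
        omega

/-! ### Gaussian binomials count crossings -/

theorem gaussBinom_succ_succ (q : F) (a b : ℕ) :
    gaussBinom q (a + 1) (b + 1) = gaussBinom q a (b + 1) + q ^ (a - b) * gaussBinom q a b := by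
  simp [gaussBinom, gaussPoly]

theorem crossings_insert_left {α : Type*} [LinearOrder α] {m : α} {U V : Finset α}
    (hU : m ∉ U) (hV : ∀ l ∈ V, m < l) : crossings (insert m U) V = #V + crossings U V := by
  rw [crossings, insert_eq, union_product, singleton_product, filter_union,
    card_union_of_disjoint, crossings]
  · congr 1
    rw [filter_true_of_mem, card_map]
    simp only [mem_map]
    rintro _ ⟨l, hl, rfl⟩
    exact hV l hl
  · rw [disjoint_left]
    rintro ⟨k, l⟩ h1 h2
    simp only [mem_filter, mem_map, mem_product] at h1 h2
    obtain ⟨⟨_, _, h⟩, _⟩ := h1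
    obtain rfl : m = k := congrArg Prod.fst h
    exact hU h2.1.1

theorem crossings_insert_right {α : Type*} [LinearOrder α] {m : α} {U V : Finset α}
    (hU : ∀ k ∈ U, m < k) : crossings U (insert m V) = crossings U V := by
  rw [crossings, crossings]
  congr 1
  ext ⟨k, l⟩
  simp only [mem_filter, mem_product, mem_insert]
  constructor
  · rintro ⟨⟨h1, rfl | h2⟩, h3⟩
    · exact absurd h3 (not_lt.2 (hU k h1).le)
    · exact ⟨⟨h1, h2⟩, h3⟩
  · rintro ⟨⟨h1, h2⟩, h3⟩
    exact ⟨⟨h1, Or.inr h2⟩, h3⟩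

/-- The recursion that defines `gaussPoly` results from separating the sets `U` that contain the
least element of `D` from those that do not. -/
theorem sum_pow_crossings {α : Type*} [LinearOrder α] (q : F) (D : Finset α) (b : ℕ) :
    ∑ U ∈ powersetCard b D, q ^ crossings U (D \ U) = gaussBinom q #D b := by
  induction D using Finset.induction_on_min generalizing b with
  | empty =>
    cases b with
    | zero => simp [gaussBinom, gaussPoly, crossings]
    | succ b =>
      rw [powersetCard_eq_empty.2 (by simp)]
      simp [gaussBinom, gaussPoly]
  | insert m D hm ih =>
    have hmD : m ∉ D := fun h => lt_irrefl _ (hm m h)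
    cases b with
    | zero => simp [gaussBinom, gaussPoly, crossings]
    | succ b =>
      rw [card_insert_of_notMem hmD, gaussBinom_succ_succ, ← ih, ← ih,
        powersetCard_succ_insert hmD, sum_union, sum_image, mul_sum]
      · congr 1
        · refine sum_congr rfl fun U hU => ?_
          have hUD := (mem_powersetCard.1 hU).1
          rw [insert_sdiff_of_notMem _ fun h => hmD (hUD h),
            crossings_insert_right fun k hk => hm k (hUD hk)]
        · refine sum_congr rfl fun U hU => ?_
          have hUD := (mem_powersetCard.1 hU).1
          rw [insert_sdiff_insert, sdiff_insert_of_notMem hmD,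
            crossings_insert_left (fun h => hmD (hUD h)) fun l hl => hm l (mem_sdiff.1 hl).1,
            card_sdiff_of_subset hUD, (mem_powersetCard.1 hU).2, pow_add]
      · intro U hU V hV e
        have hU' : m ∉ U := fun h => hmD ((mem_powersetCard.1 hU).1 h)
        have hV' : m ∉ V := fun h => hmD ((mem_powersetCard.1 hV).1 h)
        rw [← erase_insert hU', ← erase_insert hV']
        exact congrArg (fun W => W.erase m) e
      · rw [disjoint_left]
        intro U hU hU'
        obtain ⟨V, _, rfl⟩ := mem_image.1 hU'
        exact hmD ((mem_powersetCard.1 hU).1 (mem_insert_self m V))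

/-! ### Crossings row by row -/

theorem crossings_eq_sum_rows (lam : WeakComposition n) (U V : Finset (Fin n)) :
    crossings U V = ∑ i ∈ lam.parts.support,
      (#{l ∈ V | i < lam.rowOf l} * #{k ∈ U | lam.rowOf k = i} +
        crossings {k ∈ U | lam.rowOf k = i} {l ∈ V | lam.rowOf l = i}) := by
  rw [crossings, card_eq_sum_card_fiberwise (f := fun p => lam.rowOf p.1)
    (t := lam.parts.support) fun p _ => rowOf_mem_support lam p.1]
  refine sum_congr rfl fun i _ => ?_
  rw [mul_comm, ← card_product, crossings, ← card_union_of_disjoint]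
  · congr 1
    ext ⟨k, l⟩
    simp only [mem_filter, mem_product, mem_union]
    constructor
    · rintro ⟨⟨⟨h1, h2⟩, h3⟩, h4⟩
      rcases (lam.rowOf_monotone h3.le).lt_or_eq with h | h
      · exact Or.inl ⟨⟨h1, h4⟩, h2, h4 ▸ h⟩
      · exact Or.inr ⟨⟨⟨h1, h4⟩, h2, h.symm.trans h4⟩, h3⟩
    · rintro (⟨⟨h1, h2⟩, h3, h4⟩ | ⟨⟨⟨h1, h2⟩, h3, h4⟩, h5⟩)
      · exact ⟨⟨⟨h1, h3⟩, lam.rowOf_monotone.reflect_lt (h2 ▸ h4)⟩, h2⟩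
      · exact ⟨⟨⟨h1, h3⟩, h5⟩, h2⟩
  · rw [disjoint_left]
    rintro ⟨k, l⟩ h1 h2
    simp only [mem_filter, mem_product] at h1 h2
    omega

/-- Summing over the sets `U` with prescribed row counts `β i`, row by row. The number `x i` of
places outside `U` in later rows is determined by `β`. -/
theorem sum_pow_crossings_rows (q : F) (lam : WeakComposition n) (D : Finset (Fin n)) (β x : ℕ → ℕ)
    (hx : ∀ U ⊆ D, (∀ i ∈ lam.parts.support, #{k ∈ U | lam.rowOf k = i} = β i) →
      ∀ i, #{l ∈ D \ U | i < lam.rowOf l} = x i) :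
    ∑ U ∈ D.powerset with ∀ i ∈ lam.parts.support, #{k ∈ U | lam.rowOf k = i} = β i,
        q ^ crossings U (D \ U) =
      ∏ i ∈ lam.parts.support, q ^ (x i * β i) * gaussBinom q #{k ∈ D | lam.rowOf k = i} (β i) := by
  simp only [← sum_pow_crossings, mul_sum]
  rw [prod_sum]
  refine sum_bij' (fun U _ i _ => {k ∈ U | lam.rowOf k = i})
    (fun p _ => ({k | k ∈ p (lam.rowOf k) (rowOf_mem_support lam k)} : Finset (Fin n)))
    ?_ ?_ ?_ ?_ ?_
  · intro U hU
    simp only [mem_filter, mem_powerset] at hU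
    rw [mem_pi]
    intro i hi
    exact mem_powersetCard.2 ⟨filter_subset_filter _ hU.1, hU.2 i hi⟩
  · intro p hp
    simp only [mem_pi, mem_powersetCard] at hp
    simp only [mem_filter, mem_powerset]
    refine ⟨fun k hk => ?_, fun i hi => ?_⟩
    · have := (hp _ (rowOf_mem_support lam k)).1 (mem_filter.1 hk).2
      exact (mem_filter.1 this).1
    · rw [← (hp i hi).2]
      congr 1
      ext k
      simp only [mem_filter, mem_univ, true_and]
      constructor
      · rintro ⟨h, rfl⟩; exact h
      · intro h
        obtain rfl := (mem_filter.1 ((hp i hi).1 h)).2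
        exact ⟨h, rfl⟩
  · intro U _
    ext k; simp
  · intro p hp
    simp only [mem_pi, mem_powersetCard] at hp
    funext i hi
    ext k
    simp only [mem_filter, mem_univ, true_and]
    constructor
    · rintro ⟨h, rfl⟩; exact h
    · intro h
      obtain rfl := (mem_filter.1 ((hp i hi).1 h)).2
      exact ⟨h, rfl⟩
  · intro U hU
    simp only [mem_filter, mem_powerset] at hU
    rw [prod_attach lam.parts.support fun i => q ^ (x i * β i) *
      q ^ crossings {k ∈ U | lam.rowOf k = i}
        ({k ∈ D | lam.rowOf k = i} \ {k ∈ U | lam.rowOf k = i}),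
      crossings_eq_sum_rows lam, ← prod_pow_eq_pow_sum]
    refine prod_congr rfl fun i hi => ?_
    rw [pow_add, hx U hU.1 hU.2, hU.2 i hi]
    congr 3
    ext k
    simp only [mem_filter, mem_sdiff]
    tauto

/-! ### Row standard tableaux and replacements -/

theorem SameRows.card_eq {lam : WeakComposition n} {f g : Fin n → ℕ} (h : SameRows lam f g)
    (P : ℕ → ℕ → Prop) [∀ i r, Decidable (P i r)] :
    #{k | P (lam.rowOf k) (f k)} = #{k | P (lam.rowOf k) (g k)} := by
  have key : ∀ f' : Fin n → ℕ, (∀ k, (lam.rowOf k, f' k) ∈ lam.parts.support ×ˢ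
      (univ.image f ∪ univ.image g)) → #{k | P (lam.rowOf k) (f' k)} =
      ∑ p ∈ lam.parts.support ×ˢ (univ.image f ∪ univ.image g),
        if P p.1 p.2 then #{k | lam.rowOf k = p.1 ∧ f' k = p.2} else 0 := by
    intro f' hf'
    rw [card_eq_sum_card_fiberwise fun k _ => hf' k]
    refine sum_congr rfl fun p _ => ?_
    rw [filter_filter]
    split_ifs with hp
    · refine congrArg card (filter_congr fun k _ => ?_)
      rw [Prod.ext_iff]
      refine ⟨fun hk => hk.2, fun hk => ⟨?_, hk⟩⟩
      rw [hk.1, hk.2]; exact hp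
    · rw [card_eq_zero, filter_eq_empty_iff]
      rintro k - ⟨hk, rfl⟩
      exact hp hk
  rw [key f fun k => mem_product.2 ⟨rowOf_mem_support lam k, by simp⟩,
    key g fun k => mem_product.2 ⟨rowOf_mem_support lam k, by simp⟩]
  exact sum_congr rfl fun p _ => by rw [h]

theorem Tableau.rowStandard_iff {lam mu : WeakComposition n} {A : Tableau lam mu} :
    A.RowStandard ↔ ∀ k l, lam.rowOf k = lam.rowOf l → k ≤ l → A.word k ≤ A.word l := by
  have key : ∀ c c' : lam.Node, c.row = c'.row → (c.col ≤ c'.col ↔ c ≤ c') := by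
    intro c c' h
    rw [← Subtype.coe_le_coe, Prod.Lex.le_iff]
    change _ ↔ c.row < c'.row ∨ c.row = c'.row ∧ c.col ≤ c'.col
    omega
  constructor
  · intro hA k l hr hkl
    exact hA _ _ hr ((key _ _ hr).2 (by simpa using hkl))
  · intro hA c c' hr hc
    have := hA (lam.initialTableau c) (lam.initialTableau c') (by simpa [rowOf] using hr)
      (by simpa using (key c c' hr).1 hc)
    simpa only [word_initialTableau] using this

/-- If `f k < g k`, then in the row of `k` the places with `g ≤ f k` are a proper subset of those with
`f ≤ f k`, against the equality of the letter counts. -/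
theorem SameRows.le_of_rowStandard {lam : WeakComposition n} {f g : Fin n → ℕ}
    (h : SameRows lam f g)
    (hf : ∀ k l, lam.rowOf k = lam.rowOf l → k ≤ l → f k ≤ f l)
    (hg : ∀ k l, lam.rowOf k = lam.rowOf l → k ≤ l → g k ≤ g l) (k : Fin n) : g k ≤ f k := by
  by_contra hlt
  rw [not_le] at hlt
  refine (card_lt_card (s := ({l | lam.rowOf l = lam.rowOf k ∧ g l ≤ f k} : Finset (Fin n)))
    (t := ({l | lam.rowOf l = lam.rowOf k ∧ f l ≤ f k} : Finset (Fin n))) ?_).ne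
    (h.card_eq fun i r => i = lam.rowOf k ∧ r ≤ f k).symm
  rw [ssubset_iff_of_subset]
  · exact ⟨k, by simp, by simpa using hlt⟩
  · intro l hl
    simp only [mem_filter, mem_univ, true_and] at hl ⊢
    refine ⟨hl.1, hf l k hl.1 (le_of_not_gt fun hkl => ?_)⟩
    have := hg k l hl.1.symm hkl.le
    omega

theorem Tableau.RowStandard.eq_of_rowEquiv {lam mu : WeakComposition n} {A B : Tableau lam mu}
    (hA : A.RowStandard) (hB : B.RowStandard) (h : A.RowEquiv B) : A = B := by
  rw [rowStandard_iff] at hA hB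
  rw [rowEquiv_iff] at h
  have h' : SameRows lam B.word A.word := fun i r => (h i r).symm
  exact word_injective (funext fun k =>
    le_antisymm (h'.le_of_rowStandard hB hA k) (h.le_of_rowStandard hA hB k))

theorem changed_setLetter {d : ℕ} {U : Finset (Fin n)} {f : Fin n → ℕ}
    (hU : ∀ k ∈ U, f k = d + 1) : ({k | setLetter d U f k ≠ f k} : Finset (Fin n)) = U := by
  ext k
  rw [mem_filter_univ, setLetter]
  split_ifs with h
  · simp [h, hU k h]
  · simp [h]

theorem mem_replacements_iff {lam mu : WeakComposition n} {d t : ℕ} {ht : t < mu.parts (d + 1)}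
    {A : Tableau lam mu} {S : Tableau lam (nu mu d t ht)} :
    S ∈ replacements d t ht A ↔ S.RowStandard ∧
      ∃ U ∈ powersetCard (mu.parts (d + 1) - t) {k | A.word k = d + 1},
        S.word = setLetter d U A.word := by
  simp only [replacements, mem_filter, mem_univ, true_and]
  refine and_congr_right fun _ => ?_
  rw [card_node_eq fun c => S.entry c ≠ A.entry c]
  change #{k | S.word k ≠ A.word k} = _ ∧ _ ↔ _
  constructor
  · rintro ⟨h1, h2⟩
    have h2' : ∀ k, S.word k ≠ A.word k → A.word k = d + 1 ∧ S.word k = d := fun k => h2 _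
    refine ⟨({k | S.word k ≠ A.word k} : Finset (Fin n)),
      mem_powersetCard.2 ⟨fun k hk => ?_, h1⟩, funext fun k => ?_⟩
    · simpa using (h2' k (by simpa using hk)).1
    · simp only [setLetter, mem_filter, mem_univ, true_and]
      split_ifs with hk
      · exact (h2' k hk).2
      · exact not_not.1 hk
  · rintro ⟨U, hU, hS⟩
    rw [mem_powersetCard] at hU
    have hU' : ∀ k ∈ U, A.word k = d + 1 := fun k hk => by simpa using hU.1 hk
    refine ⟨by rw [hS, changed_setLetter hU', hU.2], fun c hc => ?_⟩
    rw [← S.word_initialTableau, ← A.word_initialTableau] at hc ⊢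
    have hk : lam.initialTableau c ∈ U := by
      by_contra hk
      exact hc (by rw [hS, setLetter, if_neg hk])
    exact ⟨hU' _ hk, by rw [hS, setLetter, if_pos hk]⟩

/-- There are initial segments of every size in a finite linear order. -/
theorem exists_initial_subset {α : Type*} [LinearOrder α] (D : Finset α) (b : ℕ) (hb : b ≤ #D) :
    ∃ Y ∈ powersetCard b D, ∀ x ∈ D, ∀ y ∈ Y, x ≤ y → x ∈ Y := by
  induction b with
  | zero => exact ⟨∅, by simp, by simp⟩
  | succ b ih =>
    obtain ⟨Y, hY, hi⟩ := ih (by omega)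
    rw [mem_powersetCard] at hY
    have hne : (D \ Y).Nonempty := by
      rw [← card_pos, card_sdiff_of_subset hY.1]; omega
    have hm := mem_sdiff.1 (min'_mem _ hne)
    refine ⟨insert ((D \ Y).min' hne) Y, mem_powersetCard.2
      ⟨insert_subset hm.1 hY.1, by rw [card_insert_of_notMem hm.2, hY.2]⟩, ?_⟩
    intro x hx y hy hxy
    by_contra hxY
    rw [mem_insert, not_or] at hxY
    rcases mem_insert.1 hy with rfl | hy
    · exact hxY.1 (le_antisymm hxy (min'_le _ _ (mem_sdiff.2 ⟨hx, hxY.2⟩)))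
    · exact hxY.2 (hi x hx y hy hxy)

theorem card_rows_eq {lam : WeakComposition n} {U V : Finset (Fin n)}
    (h : ∀ i ∈ lam.parts.support, #{k ∈ U | lam.rowOf k = i} = #{k ∈ V | lam.rowOf k = i}) (i : ℕ) :
    #{k ∈ U | lam.rowOf k = i} = #{k ∈ V | lam.rowOf k = i} := by
  by_cases hi : i ∈ lam.parts.support
  · exact h i hi
  · have : ∀ W : Finset (Fin n), #{k ∈ W | lam.rowOf k = i} = 0 := fun W => by
      rw [card_eq_zero, filter_eq_empty_iff]
      rintro k - rfl
      exact hi (rowOf_mem_support lam k)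
    rw [this, this]

/-- If `d + 1` is replaced by `d` at the places of `U` in a tableau row equivalent to `A`, then the
same numbers of letters `d + 1` can be replaced in the rows of `A` so that the result is row
standard: the leftmost ones have to be chosen. -/
theorem exists_mem_replacements {lam mu : WeakComposition n} {d t : ℕ}
    (ht : t < mu.parts (d + 1)) {A : Tableau lam mu} (hA : A.RowStandard) {f : Fin n → ℕ}
    (hf : SameRows lam f A.word) {U : Finset (Fin n)}
    (hU : U ∈ powersetCard (mu.parts (d + 1) - t) {k | f k = d + 1}) :
    ∃ S ∈ replacements d t ht A, ∃ V ∈ powersetCard (mu.parts (d + 1) - t) {k | A.word k = d + 1},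
      S.word = setLetter d V A.word ∧
      ∀ i, #{k ∈ U | lam.rowOf k = i} = #{k ∈ V | lam.rowOf k = i} := by
  rw [mem_powersetCard] at hU
  have hY : ∀ i, ∃ Y ∈ powersetCard #{k ∈ U | lam.rowOf k = i}
      ({k | lam.rowOf k = i ∧ A.word k = d + 1} : Finset (Fin n)),
      ∀ x ∈ ({k | lam.rowOf k = i ∧ A.word k = d + 1} : Finset (Fin n)), ∀ y ∈ Y,
        x ≤ y → x ∈ Y := fun i => by
    refine exists_initial_subset _ _ ?_
    rw [← hf]
    refine card_le_card fun k hk => ?_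
    rw [mem_filter] at hk
    have := hU.1 hk.1
    simp only [mem_filter, mem_univ, true_and] at this ⊢
    exact ⟨hk.2, this⟩
  choose Y hY hi using hY
  simp only [mem_powersetCard] at hY
  have hYm : ∀ i, ∀ k ∈ Y i, lam.rowOf k = i ∧ A.word k = d + 1 := fun i k hk => by
    simpa using (hY i).1 hk
  let V : Finset (Fin n) := {k | k ∈ Y (lam.rowOf k)}
  have hVm : ∀ k, k ∈ V ↔ k ∈ Y (lam.rowOf k) := fun k => by simp [V]
  have hVA : ∀ k ∈ V, A.word k = d + 1 := fun k hk => (hYm _ k ((hVm k).1 hk)).2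
  have hrow : ∀ i, #{k ∈ U | lam.rowOf k = i} = #{k ∈ V | lam.rowOf k = i} := fun i => by
    rw [← (hY i).2]
    congr 1
    ext k
    rw [mem_filter, hVm]
    constructor
    · intro h
      obtain rfl := (hYm i k h).1
      exact ⟨h, rfl⟩
    · rintro ⟨h, rfl⟩; exact h
  have hVc : #V = mu.parts (d + 1) - t := by
    rw [← hU.2, card_eq_sum_rows lam, card_eq_sum_rows lam U]
    exact sum_congr rfl fun i _ => (hrow i).symm
  have hVp : V ∈ powersetCard (mu.parts (d + 1) - t) {k | A.word k = d + 1} :=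
    mem_powersetCard.2 ⟨fun k hk => by simpa using hVA k hk, hVc⟩
  have hS := Tableau.word_ofWord lam _
    ((hasContent_setLetter ht hVA hVc).2 A.hasContent_word)
  refine ⟨_, mem_replacements_iff.2 ⟨?_, V, hVp, hS⟩, V, hVp, hS, hrow⟩
  rw [Tableau.rowStandard_iff] at hA ⊢
  rw [hS]
  intro k l hkl hle
  have h1 := hA k l hkl hle
  simp only [setLetter]
  split_ifs with hk hl hl
  · exact le_rfl
  · have := hVA k hk; omega
  · have h2 := hVA l hl
    by_contra h3
    refine hk ((hVm k).2 (hi _ k ?_ l (hkl ▸ (hVm l).1 hl) hle))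
    simp only [mem_filter, mem_univ, true_and]
    omega
  · exact h1

/-! ### The coefficients and the composition formula -/

theorem coeff_eq (q : F) {lam mu nu : WeakComposition n} (d : ℕ) (A : Tableau lam mu)
    (S : Tableau lam nu) : coeff q d A S = ∏ i ∈ lam.parts.support,
      q ^ (#{k | i < lam.rowOf k ∧ A.word k = d} *
        #{k | lam.rowOf k = i ∧ S.word k ≠ A.word k}) *
      gaussBinom q #{k | lam.rowOf k = i ∧ S.word k = d}
        #{k | lam.rowOf k = i ∧ S.word k ≠ A.word k} := by
  simp only [coeff, card_node_eq]
  rfl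

/-- For a word `g` that is row equivalent to `S`, the sets `U` of places such that raising the letter
`d` to `d + 1` at the places in `U` turns `g` into a word that is row equivalent to `A`. This is
expressed by the numbers of places in each row, see `sameRows_raising`. -/
noncomputable def raisings {lam mu nu : WeakComposition n} (d : ℕ) (A : Tableau lam mu)
    (S : Tableau lam nu) (g : Fin n → ℕ) : Finset (Finset (Fin n)) :=
  {U ∈ powerset {k | g k = d} | ∀ i ∈ lam.parts.support,
    #{k ∈ U | lam.rowOf k = i} = #{k | lam.rowOf k = i ∧ S.word k ≠ A.word k}}

theorem mem_raisings {lam mu nu : WeakComposition n} {d : ℕ} {A : Tableau lam mu}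
    {S : Tableau lam nu} {g : Fin n → ℕ} {V : Finset (Fin n)} (hV : ∀ k ∈ V, A.word k = d + 1)
    (hS : S.word = setLetter d V A.word) {U : Finset (Fin n)} :
    U ∈ raisings d A S g ↔ (∀ k ∈ U, g k = d) ∧
      ∀ i, #{k ∈ U | lam.rowOf k = i} = #{k ∈ V | lam.rowOf k = i} := by
  have e : ∀ i, #{k | lam.rowOf k = i ∧ S.word k ≠ A.word k} = #{k ∈ V | lam.rowOf k = i} := by
    intro i
    conv_rhs => rw [← changed_setLetter hV, ← hS, filter_filter]
    simp only [and_comm]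
  simp only [raisings, mem_filter, mem_powerset, e]
  refine and_congr ⟨fun h k hk => by simpa using h hk, fun h k hk => by simpa using h k hk⟩
    ⟨card_rows_eq, fun h i _ => h i⟩

theorem filter_setLetter_succ {d : ℕ} (U : Finset (Fin n)) (g : Fin n → ℕ) :
    ({k | setLetter (d + 1) U g k = d} : Finset (Fin n)) =
      ({k | g k = d} : Finset (Fin n)) \ U := by
  ext k
  rw [mem_sdiff, mem_filter_univ, mem_filter_univ, setLetter]
  split_ifs with h <;> simp [h]

theorem sameRows_raising {lam mu nu : WeakComposition n} {d : ℕ} {A : Tableau lam mu}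
    {S : Tableau lam nu} {g : Fin n → ℕ} {V : Finset (Fin n)} (hV : ∀ k ∈ V, A.word k = d + 1)
    (hS : S.word = setLetter d V A.word) (hg : SameRows lam g S.word) {U : Finset (Fin n)}
    (hU : U ∈ raisings d A S g) : SameRows lam (setLetter (d + 1) U g) A.word := by
  rw [mem_raisings hV hS] at hU
  rw [hS, ← setLetter_setLetter (e := d + 1) hU.1] at hg
  refine (sameRows_setLetter (fun k hk => ?_) hV hU.2).1 hg
  rw [setLetter, if_pos hk]

/-- The coefficient `b_S` counts the raisings of any word row equivalent to `S`, weighted by their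
crossings. -/
theorem coeff_eq_sum_raisings (q : F) {lam mu nu : WeakComposition n} {d : ℕ} {A : Tableau lam mu}
    {S : Tableau lam nu} {g : Fin n → ℕ} {V : Finset (Fin n)} (hV : ∀ k ∈ V, A.word k = d + 1)
    (hS : S.word = setLetter d V A.word) (hg : SameRows lam g S.word) :
    coeff q d A S = ∑ U ∈ raisings d A S g,
      q ^ crossings U {k | setLetter (d + 1) U g k = d} := by
  simp only [filter_setLetter_succ]
  rw [raisings, sum_pow_crossings_rows q lam _ _
    (fun i => #{k | i < lam.rowOf k ∧ A.word k = d}), coeff_eq]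
  · refine prod_congr rfl fun i _ => ?_
    congr 2
    rw [← hg, filter_filter]
    simp only [and_comm]
  · intro U hU hr i
    have h := sameRows_raising hV hS hg (U := U)
      (mem_filter.2 ⟨mem_powerset.2 hU, hr⟩)
    rw [← h.card_eq fun j r => i < j ∧ r = d, ← filter_setLetter_succ, filter_filter]
    simp only [and_comm]

open Classical in
/-- The two sides of the composition formula, expanded in the word basis of `M^ν`. A tableau `A'`
together with the set `U` of places at which `d + 1` is replaced corresponds to the triple `(S, B, U)`,
where `B` is the result of the replacement and `S` is the row standard tableau that is row equivalent
to `B`. -/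
theorem sum_wordElt_setLetter (q : F) {lam mu : WeakComposition n} {d t : ℕ}
    (ht : t < mu.parts (d + 1)) {A : Tableau lam mu} (hA : A.RowStandard) :
    ∑ A' : Tableau lam mu with A'.RowEquiv A,
        ∑ U ∈ powersetCard (mu.parts (d + 1) - t) {k | A'.word k = d + 1},
          q ^ crossings U {k | A'.word k = d} • wordElt q (nu mu d t ht) (setLetter d U A'.word) =
      ∑ S ∈ replacements d t ht A, coeff q d A S •
        ∑ B : Tableau lam (nu mu d t ht) with B.RowEquiv S, wordElt q (nu mu d t ht) B.word := by
  have hR : ∀ S ∈ replacements d t ht A, coeff q d A S •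
      ∑ B : Tableau lam (nu mu d t ht) with B.RowEquiv S, wordElt q (nu mu d t ht) B.word =
      ∑ B : Tableau lam (nu mu d t ht) with B.RowEquiv S, ∑ U ∈ raisings d A S B.word,
        q ^ crossings U {k | setLetter (d + 1) U B.word k = d} •
          wordElt q (nu mu d t ht) B.word := by
    intro S hS
    obtain ⟨-, V, hV, hSV⟩ := mem_replacements_iff.1 hS
    rw [smul_sum]
    refine sum_congr rfl fun B hB => ?_
    rw [← sum_smul, coeff_eq_sum_raisings q
      (fun k hk => by simpa using (mem_powersetCard.1 hV).1 hk) hSV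
      (Tableau.rowEquiv_iff.1 (mem_filter.1 hB).2)]
  rw [sum_congr rfl hR, sum_sigma', sum_sigma', sum_sigma']
  symm
  have key : ∀ (S : Tableau lam (nu mu d t ht)) (B : Tableau lam (nu mu d t ht))
      (U : Finset (Fin n)), S ∈ replacements d t ht A → B.RowEquiv S → U ∈ raisings d A S B.word →
      U ∈ powersetCard (mu.parts (d + 1) - t) {k | setLetter (d + 1) U B.word k = d + 1} ∧
        HasContent (setLetter (d + 1) U B.word) mu ∧
        SameRows lam (setLetter (d + 1) U B.word) A.word ∧
        setLetter d U (setLetter (d + 1) U B.word) = B.word := by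
    intro S B U hS hB hU
    obtain ⟨-, V, hV, hSV⟩ := mem_replacements_iff.1 hS
    obtain ⟨hV, hVc⟩ := mem_powersetCard.1 hV
    have hVA : ∀ k ∈ V, A.word k = d + 1 := fun k hk => by simpa using hV hk
    have hsame := sameRows_raising hVA hSV (Tableau.rowEquiv_iff.1 hB) hU
    rw [mem_raisings hVA hSV] at hU
    have hUf : ∀ k ∈ U, setLetter (d + 1) U B.word k = d + 1 := fun k hk => if_pos hk
    have hUc : #U = mu.parts (d + 1) - t := by
      rw [← hVc, card_eq_sum_rows lam, card_eq_sum_rows lam V]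
      exact sum_congr rfl fun i _ => hU.2 i
    have hid := setLetter_setLetter (e := d + 1) hU.1
    refine ⟨mem_powersetCard.2 ⟨fun k hk => mem_filter_univ _ |>.2 (hUf k hk), hUc⟩, ?_, hsame, hid⟩
    rw [← hasContent_setLetter ht hUf hUc, hid]
    exact B.hasContent_word
  have key' : ∀ p ∈ ((replacements d t ht A).sigma fun S =>
      ({B : Tableau lam (nu mu d t ht) | B.RowEquiv S} : Finset _)).sigma
      fun p => raisings d A p.1 p.2.word, _ := fun p hp =>
    key p.1.1 p.1.2 p.2 (mem_sigma.1 (mem_sigma.1 hp).1).1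
      (mem_filter.1 (mem_sigma.1 (mem_sigma.1 hp).1).2).2 (mem_sigma.1 hp).2
  refine sum_bij (fun p hp => ⟨Tableau.ofWord lam _ (key' p hp).2.1, p.2⟩) ?_ ?_ ?_ ?_
  · intro p hp
    obtain ⟨h1, h2, h3, -⟩ := key' p hp
    refine mem_sigma.2 ⟨mem_filter.2 ⟨mem_univ _, ?_⟩, ?_⟩
    · rw [Tableau.rowEquiv_iff, Tableau.word_ofWord]; exact h3
    · simpa only [Tableau.word_ofWord] using h1
  · intro p hp p' hp' e
    obtain ⟨-, -, -, h4⟩ := key' p hp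
    obtain ⟨-, -, -, h4'⟩ := key' p' hp'
    have hS := mem_sigma.1 (mem_sigma.1 hp).1
    have hS' := mem_sigma.1 (mem_sigma.1 hp').1
    obtain ⟨⟨S, B⟩, U⟩ := p
    obtain ⟨⟨S', B'⟩, U'⟩ := p'
    obtain ⟨e1, e2⟩ := Sigma.mk.inj e
    obtain rfl : U = U' := eq_of_heq e2
    have e3 := congrArg Tableau.word e1
    simp only [Tableau.word_ofWord] at e3
    obtain rfl : B = B' := by
      refine Tableau.word_injective ?_
      rw [← h4, ← h4']
      exact congrArg _ e3
    have hBS := Tableau.rowEquiv_iff.1 (mem_filter.1 hS.2).2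
    have hBS' := Tableau.rowEquiv_iff.1 (mem_filter.1 hS'.2).2
    obtain rfl : S = S' := (mem_replacements_iff.1 hS.1).1.eq_of_rowEquiv
      (mem_replacements_iff.1 hS'.1).1
      (Tableau.rowEquiv_iff.2 fun i r => (hBS i r).symm.trans (hBS' i r))
    rfl
  · rintro ⟨A', U⟩ hp
    obtain ⟨hA', hU⟩ := mem_sigma.1 hp
    have hA' := Tableau.rowEquiv_iff.1 (mem_filter.1 hA').2
    obtain ⟨S, hS, V, hV, hSV, hrow⟩ := exists_mem_replacements ht hA hA' hU
    obtain ⟨hU, hUc⟩ := mem_powersetCard.1 hU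
    have hUA : ∀ k ∈ U, A'.word k = d + 1 := fun k hk => by simpa using hU hk
    have hVA : ∀ k ∈ V, A.word k = d + 1 := fun k hk => by
      simpa using (mem_powersetCard.1 hV).1 hk
    have hB := Tableau.word_ofWord lam _
      ((hasContent_setLetter ht hUA hUc).2 A'.hasContent_word)
    refine ⟨⟨⟨S, Tableau.ofWord lam _
      ((hasContent_setLetter ht hUA hUc).2 A'.hasContent_word)⟩, U⟩, mem_sigma.2
        ⟨mem_sigma.2 ⟨hS, mem_filter.2 ⟨mem_univ _, ?_⟩⟩, ?_⟩, ?_⟩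
    · rw [Tableau.rowEquiv_iff, hB, hSV, sameRows_setLetter hUA hVA hrow]
      exact hA'
    · refine (mem_raisings hVA hSV).2 ⟨fun k hk => ?_, hrow⟩
      rw [hB, setLetter, if_pos hk]
    · refine congrArg (fun A' => (⟨A', U⟩ : Σ _ : Tableau lam mu, Finset (Fin n)))
        (Tableau.word_injective ?_)
      rw [Tableau.word_ofWord]
      simp only [hB]
      exact setLetter_setLetter hUA
  · intro p hp
    obtain ⟨-, -, -, h4⟩ := key' p hp
    simp only [Tableau.word_ofWord, h4]

/-- It suffices to compare the values at the generator `x_lam`: both sides are sums over the word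
basis of `M^ν`. -/
theorem psi_comp_theta (q : F) {lam mu : WeakComposition n} (d t : ℕ)
    (ht : t < mu.parts (d + 1)) (A : Tableau lam mu) (hA : A.RowStandard) :
    psi q mu d t ht ∘ₗ theta q A = ∑ S ∈ replacements d t ht A, coeff q d A S • theta q S := by
  classical
  refine LinearMap.ext fun m => Subtype.ext ?_
  obtain ⟨m, hm⟩ := m
  obtain ⟨h, rfl⟩ := Submodule.mem_span_singleton.1 hm
  obtain ⟨h, rfl⟩ := MulOpposite.op_surjective h
  have hθ : theta q A ⟨xElt q lam * h, hm⟩ =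
      ⟨xElt q mu * ((∑ A' : Tableau lam mu with A'.RowEquiv A, HeckeAlgebra.T q A'.perm) * h),
        xElt_mul_mem q mu _⟩ := by
    refine Subtype.ext ((theta_apply q A h).trans ?_)
    rw [thetaElt, mul_assoc]
  change (psi q mu d t ht (theta q A ⟨xElt q lam * h, hm⟩) : HeckeAlgebra F q n) =
    ((∑ S ∈ replacements d t ht A, coeff q d A S • theta q S) ⟨xElt q lam * h, hm⟩ :
      permModule q (nu mu d t ht))
  rw [hθ, psi, theta_apply, ← mul_assoc, mul_sum]
  have hL : ∀ A' : Tableau lam mu,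
      thetaElt q (psiTableau mu d t ht) * HeckeAlgebra.T q A'.perm = _ := fun A' =>
    thetaElt_psiTableau_mul_T_sort q ht A'.hasContent_word
  rw [sum_congr rfl fun A' _ => hL A', sum_wordElt_setLetter q ht hA, LinearMap.sum_apply,
    AddSubmonoidClass.coe_finsetSum, sum_mul]
  refine sum_congr rfl fun S _ => ?_
  rw [LinearMap.smul_apply, Submodule.coe_smul_of_tower, theta_apply q S h, smul_mul_assoc,
    thetaElt_eq_sum_wordElt]

end Hecke

theorem mainTheorem11 {F : Type*} [Field F] (q : F) (hq : q ≠ 0) {n : ℕ}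
    (lam mu : Hecke.WeakComposition n) (hlam : lam.IsPartition) (hmu : mu.IsPartition)
    (d t : ℕ) (ht : t < mu.parts (d + 1))
    (A : Hecke.Tableau lam mu) (hA : A.RowStandard) :
    Hecke.psi q mu d t ht ∘ₗ Hecke.theta q A =
      ∑ S ∈ Hecke.replacements d t ht A, Hecke.coeff q d A S • Hecke.theta q S :=
  Hecke.psi_comp_theta q d t ht A hA
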